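/- Fix a prime $p$. Let $F=F(x_1,\dots,x_d)$ be a free group of finite rank, let $\Lambda_p=\mathbb{F}_p[[u_1,\dots,u_d]]$ be the ring of formal power series in non-commuting variables, let $I$ be its ideal generated by $u_1,\dots,u_d$, and let $\pi:F\to\Lambda_p^{*}$, $x_i\mapsto 1+u_i$, be the Magnus embedding. The degree of $1\neq f\in F$ is the unique $n\ge 1$ with $f\in D_nF\setminus D_{n+1}F$, where $D_nF=\{f\in F:\pi(f)\equiv 1 \bmod I^n\}$. For $S\subseteq F$ let $n_i(S)$ be the number of elements of $S$ of degree $i$, and let $\hat d$ be the minimal number of topological generators of the pro-$p$ completion of the group $\langle x_1,\dots,x_d\mid S\rangle$. The presentation $\langle x_1,\dots,x_d\mid S\rangle$ is called a Golod–Shafarevich presentation if all $n_i(S)$ are finite and, for some $t_0\in(0,1)$, the series $1-\hat d\,t_0+\sum_{i\ge1}n_i(S)t_0^i$ converges to a negative number. A group is recursively presented if it has a presentation with finitely many generators and a computably enumerable set of relators. A finitely generated group $H$ is algorithmically finite if, for a finite generating set $Y$ of $H$, every infinite computably enumerable subset of $F(Y)$ contains two distinct elements with the same image in $H$ (this does not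 depend on $Y$). A Dehn monster is an infinite, recursively presented, algorithmically finite group. **Corollary.** Let $G$ be a recursively presented group that is given by a Golod–Shafarevich presentation $\langle x_1,\dots,x_d\mid S\rangle$ (with respect to $p$), and let $Q$ be a property of groups that is preserved under quotients and holds for $G$. Then $G$ has a quotient $\bar G$ that is a Dehn monster, satisfies $Q$, and is given by a Golod–Shafarevich presentation $\langle x_1,\dots,x_d\mid T\rangle$ (with respect to the same $p$). Moreover, if $S$ is computably enumerable, then $T$ can be chosen computably enumerable. -/

import Mathlib

universe u

namespace GolodShafarevich

/-! ### Non-commutative formal power series and the Magnus embedding -/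

/-- The ring `R[[u_1, …, u_d]]` of formal power series in `d` non-commuting variables: a series is
the family of its coefficients, indexed by the monomials, i.e. by the words in the variables. -/
def NCSeries (R : Type) (d : ℕ) : Type := List (Fin d) → R

namespace NCSeries

variable {R : Type} [CommRing R] {d : ℕ}

instance : AddCommGroup (NCSeries R d) := inferInstanceAs (AddCommGroup (List (Fin d) → R))

instance : One (NCSeries R d) := ⟨fun w => if w = [] then 1 else 0⟩

/-- The product: the coefficient at `w` is the sum over all factorizations `w = w₁ w₂`. -/
instance : Mul (NCSeries R d) :=
  ⟨fun f g w => ∑ k ∈ Finset.range (w.length + 1), f (w.take k) * g (w.drop k)⟩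

theorem ext' {f g : NCSeries R d} (h : ∀ w, f w = g w) : f = g := funext h

/-- The series with coefficient `f (a v)` at the word `v`. -/
def tail (a : Fin d) (f : NCSeries R d) : NCSeries R d := fun v => f (a :: v)

/-- The series `c f` for a scalar `c`. -/
def scale (c : R) (f : NCSeries R d) : NCSeries R d := fun v => c * f v

theorem add_apply (f g : NCSeries R d) (w : List (Fin d)) : (f + g) w = f w + g w := rfl

theorem zero_apply (w : List (Fin d)) : (0 : NCSeries R d) w = 0 := rfl

theorem one_apply (w : List (Fin d)) : (1 : NCSeries R d) w = if w = [] then 1 else 0 := rfl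

theorem mul_apply (f g : NCSeries R d) (w : List (Fin d)) :
    (f * g) w = ∑ k ∈ Finset.range (w.length + 1), f (w.take k) * g (w.drop k) := rfl

theorem mul_nil (f g : NCSeries R d) : (f * g) [] = f [] * g [] := by
  simp [mul_apply]

theorem mul_cons (f g : NCSeries R d) (a : Fin d) (w : List (Fin d)) :
    (f * g) (a :: w) =
      f [] * g (a :: w) + (tail a f * g) w := by
  rw [mul_apply, mul_apply, List.length_cons, Finset.sum_range_succ']
  simp [add_comm, tail]

protected theorem add_mul (f g h : NCSeries R d) : (f + g) * h = f * h + g * h := by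
  apply ext'
  intro w
  simp only [mul_apply, add_apply, add_mul, Finset.sum_add_distrib]

protected theorem mul_add (f g h : NCSeries R d) : f * (g + h) = f * g + f * h := by
  apply ext'
  intro w
  simp only [mul_apply, add_apply, mul_add, Finset.sum_add_distrib]

protected theorem mul_assoc_apply (w : List (Fin d)) :
    ∀ f g h : NCSeries R d, (f * g * h) w = (f * (g * h)) w := by
  induction w with
  | nil => intro f g h; simp only [mul_nil, mul_assoc]
  | cons a w ih =>
    intro f g h
    rw [mul_cons, mul_cons f, mul_cons g, mul_nil, ← ih]
    have e : tail a (f * g) = scale (f []) (tail a g) + tail a f * g := by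
      apply ext'
      intro v
      rw [tail, mul_cons]
      rfl
    have e2 : (scale (f []) (tail a g) * h) w = f [] * (tail a g * h) w := by
      simp only [mul_apply, scale, Finset.mul_sum, mul_assoc]
    rw [e, NCSeries.add_mul, add_apply, e2]
    ring

protected theorem one_mul (f : NCSeries R d) : 1 * f = f := by
  apply ext'
  intro w
  rw [mul_apply, Finset.sum_eq_single 0]
  · simp [one_apply]
  · intro k hk hk0
    have : w.take k ≠ [] := by
      intro h
      rcases List.take_eq_nil_iff.1 h with h | h
      · exact hk0 h
      · subst h
        simp at hk
        exact hk0 hk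
    simp [one_apply, this]
  · simp

protected theorem mul_one (f : NCSeries R d) : f * 1 = f := by
  apply ext'
  intro w
  rw [mul_apply, Finset.sum_range_succ, Finset.sum_eq_zero]
  · simp [one_apply]
  · intro k hk
    have hk' := Finset.mem_range.1 hk
    have : w.drop k ≠ [] := by
      intro h
      have := List.drop_eq_nil_iff.1 h
      omega
    simp [one_apply, this]

instance : Ring (NCSeries R d) :=
  { (inferInstance : AddCommGroup (NCSeries R d)) with
    mul := (· * ·)
    one := 1
    left_distrib := NCSeries.mul_add
    right_distrib := NCSeries.add_mul
    zero_mul := fun f => ext' fun w => by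
      rw [mul_apply]
      exact Finset.sum_eq_zero fun k _ => by rw [zero_apply, zero_mul]
    mul_zero := fun f => ext' fun w => by
      rw [mul_apply]
      exact Finset.sum_eq_zero fun k _ => by rw [zero_apply, mul_zero]
    mul_assoc := fun f g h => ext' fun w => NCSeries.mul_assoc_apply w f g h
    one_mul := NCSeries.one_mul
    mul_one := NCSeries.mul_one }

/-- The variable `u_i`. -/
def X (R : Type) [CommRing R] {d : ℕ} (i : Fin d) : NCSeries R d :=
  fun w => if w = [i] then 1 else 0

/-- The series `1 - u_i + u_i ^ 2 - u_i ^ 3 + ⋯`. -/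
def geom (R : Type) [CommRing R] {d : ℕ} (i : Fin d) : NCSeries R d :=
  fun w => if w = List.replicate w.length i then (-1) ^ w.length else 0

theorem X_mul_nil (i : Fin d) (f : NCSeries R d) : (X R i * f) [] = 0 := by
  simp [mul_nil, X]

theorem X_mul_cons (i a : Fin d) (f : NCSeries R d) (w : List (Fin d)) :
    (X R i * f) (a :: w) = if a = i then f w else 0 := by
  rw [mul_cons]
  have e : tail a (X R i) = if a = i then 1 else 0 := by
    apply ext'
    intro v
    by_cases h : a = i
    · rw [if_pos h, one_apply]
      simp [tail, X, h]
    · rw [if_neg h, zero_apply]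
      simp [tail, X, h]
  rw [e]
  split_ifs with h
  · simp [X]
  · rw [zero_mul]
    simp [X, zero_apply]

theorem geom_apply_cons (i a : Fin d) (w : List (Fin d)) :
    geom R i (a :: w) = if a = i then - geom R i w else 0 := by
  by_cases h : a = i
  · by_cases h' : w = List.replicate w.length i
    · simp [geom, h, List.replicate_succ, ← h', pow_succ]
    · simp [geom, h, List.replicate_succ, h']
  · simp [geom, h, List.replicate_succ]

theorem one_add_X_mul_geom (i : Fin d) : (1 + X R i) * geom R i = 1 := by
  rw [add_mul, one_mul]
  apply ext'
  intro w
  cases w with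
  | nil => rw [add_apply, X_mul_nil]; simp [geom, one_apply]
  | cons a w =>
    rw [add_apply, X_mul_cons, geom_apply_cons]
    split_ifs <;> simp [one_apply]

theorem geom_mul_one_add_X (i : Fin d) : geom R i * (1 + X R i) = 1 := by
  have key : ∀ w : List (Fin d), (geom R i * (1 + X R i)) w = (1 : NCSeries R d) w := by
    intro w
    induction w with
    | nil => simp [mul_nil, geom, add_apply, one_apply, X]
    | cons a w ih =>
      rw [mul_cons]
      have e : tail a (geom R i) = if a = i then - geom R i else 0 := by
        apply ext'
        intro v
        rw [tail, geom_apply_cons]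
        split_ifs <;> rfl
      rw [e]
      split_ifs with h
      · rw [neg_mul]
        change _ + - (geom R i * (1 + X R i)) w = _
        rw [ih]
        by_cases hw : w = [] <;> simp [hw, h, geom, add_apply, one_apply, X]
      · rw [zero_mul]
        simp [h, geom, add_apply, one_apply, zero_apply, X]
  exact ext' key

/-- The unit `1 + u_i`. -/
def oneAddX (R : Type) [CommRing R] {d : ℕ} (i : Fin d) : (NCSeries R d)ˣ :=
  ⟨1 + X R i, geom R i, one_add_X_mul_geom i, geom_mul_one_add_X i⟩

end NCSeries

/-- The Magnus embedding `F(x_1, …, x_d) → Λ_pˣ`, `x_i ↦ 1 + u_i`, where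
`Λ_p = (ℤ/p)[[u_1, …, u_d]]`. -/
def magnus (p d : ℕ) : FreeGroup (Fin d) →* (NCSeries (ZMod p) d)ˣ :=
  FreeGroup.lift fun i => NCSeries.oneAddX (ZMod p) i

/-- The `n`-th term `D_n F = {f | f ≡ 1 mod I ^ n}` of the Zassenhaus `p`-filtration of the free
group `F`; here `I` is the ideal of `Λ_p` generated by the variables, so that `I ^ n` consists of
the series all of whose coefficients at words of length less than `n` vanish. -/
def zassenhaus (p d n : ℕ) : Set (FreeGroup (Fin d)) :=
  {f | ∀ w : List (Fin d), w.length < n →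
    ((magnus p d f : NCSeries (ZMod p) d) - 1) w = 0}

/-- The elements of `S` of degree exactly `n`. -/
def relatorsOfDegree (p : ℕ) {d : ℕ} (S : Set (FreeGroup (Fin d))) (n : ℕ) :
    Set (FreeGroup (Fin d)) :=
  {r | r ∈ S ∧ r ∈ zassenhaus p d n ∧ r ∉ zassenhaus p d (n + 1)}

/-! ### The pro-`p` completion -/

/-- The normal subgroups of `G` whose index is a (finite) power of `p`. -/
structure PowIndexSubgroup (p : ℕ) (G : Type*) [Group G] where
  toSubgroup : Subgroup G
  normal : toSubgroup.Normal
  index_eq : ∃ k : ℕ, toSubgroup.index = p ^ k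

instance {p : ℕ} {G : Type*} [Group G] (N : PowIndexSubgroup p G) : N.toSubgroup.Normal := N.normal

/-- The finite `p`-group `G / N`, as a discrete group. -/
def PQuotient {p : ℕ} {G : Type*} [Group G] (N : PowIndexSubgroup p G) : Type _ :=
  G ⧸ N.toSubgroup

instance {p : ℕ} {G : Type*} [Group G] (N : PowIndexSubgroup p G) : Group (PQuotient N) :=
  inferInstanceAs (Group (G ⧸ N.toSubgroup))

instance {p : ℕ} {G : Type*} [Group G] (N : PowIndexSubgroup p G) :
    TopologicalSpace (PQuotient N) := ⊥

/-- The canonical map `G / N → G / M` for `N ≤ M`. -/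
def PQuotient.map {p : ℕ} {G : Type*} [Group G] {N M : PowIndexSubgroup p G}
    (h : N.toSubgroup ≤ M.toSubgroup) : PQuotient N →* PQuotient M :=
  QuotientGroup.map N.toSubgroup M.toSubgroup (MonoidHom.id G) h

/-- The pro-`p` completion of `G`: the inverse limit of the quotients of `G` by the normal
subgroups of `p`-power index, as a subgroup of their product. It carries the subspace topology of
the product of the discrete groups `G / N`. -/
def proPCompletion (p : ℕ) (G : Type*) [Group G] :
    Subgroup (∀ N : PowIndexSubgroup p G, PQuotient N) where
  carrier := {x | ∀ (N M : PowIndexSubgroup p G) (h : N.toSubgroup ≤ M.toSubgroup),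
    PQuotient.map h (x N) = x M}
  mul_mem' := by
    intro x y hx hy N M h
    rw [Pi.mul_apply, Pi.mul_apply, map_mul, hx N M h, hy N M h]
  one_mem' := by
    intro N M h
    rw [Pi.one_apply, Pi.one_apply, map_one]
  inv_mem' := by
    intro x hx N M h
    rw [Pi.inv_apply, Pi.inv_apply, map_inv, hx N M h]

/-- The minimal number of topological generators of a (topologically finitely generated)
topological group. -/
noncomputable def topRank (H : Type*) [Group H] [TopologicalSpace H] : ℕ :=
  sInf {n : ℕ | ∃ s : Fin n → H, Dense (Subgroup.closure (Set.range s) : Set H)}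

/-- `⟨x_1, …, x_d | S⟩` is a Golod–Shafarevich presentation (for the prime `p`): for some
`t ∈ (0, 1)` the series `H_p(t) = 1 - d̂ t + ∑_{i ≥ 1} n_i(S) t ^ i` converges to a negative number.
Here `n_i(S)`, which has to be finite, is the number of relators of degree `i`, and `d̂` is the
minimal number of topological generators of the pro-`p` completion of `⟨x_1, …, x_d | S⟩`. -/
def IsGolodShafarevichPresentation (p : ℕ) {d : ℕ} (S : Set (FreeGroup (Fin d))) : Prop :=
  (∀ i : ℕ, (relatorsOfDegree p S (i + 1)).Finite) ∧
  ∃ t : ℝ, 0 < t ∧ t < 1 ∧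
    Summable (fun i : ℕ => ((relatorsOfDegree p S (i + 1)).ncard : ℝ) * t ^ (i + 1)) ∧
    1 - (topRank (proPCompletion p (PresentedGroup S)) : ℝ) * t +
      ∑' i : ℕ, ((relatorsOfDegree p S (i + 1)).ncard : ℝ) * t ^ (i + 1) < 0

/-! ### Computability in finitely generated groups -/

/-- A set of elements of the free group of rank `d` is computably enumerable: there is an algorithm
that halts on exactly those words in the letters `x_i`, `x_i⁻¹` that represent an element of `S`. -/
def IsCE {d : ℕ} (S : Set (FreeGroup (Fin d))) : Prop :=
  REPred fun L : List (Fin d × Bool) => FreeGroup.mk L ∈ S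

/-- `G` has a presentation with finitely many generators and a computably enumerable set of
relators. -/
def IsRecursivelyPresented (G : Type*) [Group G] : Prop :=
  ∃ (d : ℕ) (S : Set (FreeGroup (Fin d))), IsCE S ∧ Nonempty (PresentedGroup S ≃* G)

/-- `G` is algorithmically finite: for a finite generating family `η` of `G`, every infinite
computably enumerable set of elements of the free group contains two distinct elements with the
same image in `G`. -/
def IsAlgorithmicallyFinite (G : Type*) [Group G] : Prop :=
  ∃ (d : ℕ) (η : FreeGroup (Fin d) →* G), Function.Surjective η ∧
    ∀ W : Set (FreeGroup (Fin d)), W.Infinite → IsCE W →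
      ∃ u ∈ W, ∃ v ∈ W, u ≠ v ∧ η u = η v

/-- A Dehn monster: an infinite recursively presented algorithmically finite group. -/
def IsDehnMonster (G : Type*) [Group G] : Prop :=
  Infinite G ∧ IsRecursivelyPresented G ∧ IsAlgorithmicallyFinite G

end GolodShafarevich

namespace GolodShafarevich

/-! ### The Golod–Shafarevich inequality -/

namespace NCSeries

section LinearStructure

variable {K : Type} [Field K] {d : ℕ} {ι : Type}

/-! The quotient is obtained by adding at most one relator for each program `e`. If `e` enumerates
an infinite set `W` of words up to free equality, then two distinct elements `u`, `v` of `W` agree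
modulo `I ^ (N + e)`, because the series ring over `ZMod p` modulo a power of `I` is finite
(`exists_sameLowCoefs_of_infinite`). The relator `u⁻¹ * v` makes them collide in the quotient and
lies in the `(N + e)`-th Zassenhaus term. Taking such a pair for every `e` that has one gives
algorithmic finiteness (`exists_mem_collisionRelators`). Collisions are decidable, so taking the
first one found keeps the relators computably enumerable (`isCE_image_collisionRelators`).

At most `i + 1 - N` of the new relators (truncated subtraction) have degree `i`, so their
contribution to the Golod–Shafarevich series at the given `t` tends to 0 as `N` grows. For `N ≥ 2`
they also lie in the second Zassenhaus term, which every character to `ℤ/p` kills. By a Burnside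
basis argument the rank of the pro-`p` completion is determined by the characters that kill the
relators, hence is unchanged (`topRank_union_eq`). The enlarged presentation is therefore still
Golod–Shafarevich for large `N`.

Infinitude is the Golod–Shafarevich theorem. Let `J` be the ideal generated by the series `π(r) -
1`, let `a n` be the dimension of the series ring modulo `J + I ^ n`, and let `c i` be the number of
relators of degree `i + 1`. Comparing `J + I ^ (n + 1)` with `I * (J + I ^ n)` gives `1 + d * a n ≤
a (n + 1) + ∑ c i * a (n - i)` (`one_add_mul_relDim_le`). A negative value of the series makes `a`
unbounded (`unbounded_of_golodShafarevich`), whereas a finite presented group would bound `a n` by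
its order (`relDim_relatorSeries_le_card`). This argument uses `d` in place of the rank of the
completion, which is at most `d`. -/

instance : Module K (NCSeries K d) := inferInstanceAs (Module K (List (Fin d) → K))

theorem smul_apply (c : K) (f : NCSeries K d) (w : List (Fin d)) : (c • f) w = c * f w := rfl

theorem sub_apply (f g : NCSeries K d) (w : List (Fin d)) : (f - g) w = f w - g w := rfl

instance : IsScalarTower K (NCSeries K d) (NCSeries K d) where
  smul_assoc c f g := ext' fun w => by
    simp only [smul_eq_mul, smul_apply, mul_apply, Finset.mul_sum, mul_assoc]

instance : SMulCommClass K (NCSeries K d) (NCSeries K d) where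
  smul_comm c f g := ext' fun w => by
    simp only [smul_eq_mul, smul_apply, mul_apply, Finset.mul_sum, mul_left_comm]

/-- The `n`-th power of the augmentation ideal: the series whose coefficients at words of length
less than `n` vanish. -/
def lowOrder (K : Type) [Field K] (d n : ℕ) : Submodule K (NCSeries K d) where
  carrier := {f | ∀ w : List (Fin d), w.length < n → f w = 0}
  add_mem' hf hg w hw := by rw [add_apply, hf w hw, hg w hw, add_zero]
  zero_mem' w _ := rfl
  smul_mem' c f hf w hw := by rw [smul_apply, hf w hw, mul_zero]

theorem mul_mem_lowOrder_add {m n : ℕ} {f g : NCSeries K d} (hf : f ∈ lowOrder K d m)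
    (hg : g ∈ lowOrder K d n) : f * g ∈ lowOrder K d (m + n) := by
  intro w hw
  rw [mul_apply]
  refine Finset.sum_eq_zero fun k hk => ?_
  have hk := Finset.mem_range.1 hk
  by_cases h : k < m
  · rw [hf _ (by rw [List.length_take]; omega), zero_mul]
  · rw [hg _ (by rw [List.length_drop]; omega), mul_zero]

theorem mem_lowOrder_zero (f : NCSeries K d) : f ∈ lowOrder K d 0 := fun _ hw => by omega

theorem mul_mem_lowOrder_left {n : ℕ} (f : NCSeries K d) {g : NCSeries K d}
    (hg : g ∈ lowOrder K d n) : f * g ∈ lowOrder K d n := by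
  simpa using mul_mem_lowOrder_add (mem_lowOrder_zero f) hg

theorem mul_mem_lowOrder_right {n : ℕ} {f : NCSeries K d} (hf : f ∈ lowOrder K d n)
    (g : NCSeries K d) : f * g ∈ lowOrder K d n := by
  simpa using mul_mem_lowOrder_add hf (mem_lowOrder_zero g)

theorem lowOrder_antitone {m n : ℕ} (h : m ≤ n) : lowOrder K d n ≤ lowOrder K d m :=
  fun _ hf w hw => hf w (hw.trans_le h)

/-- The words of length less than `n`. -/
abbrev ShortWord (d n : ℕ) : Type := {w : List (Fin d) // w.length < n}

instance (d n : ℕ) : Finite (ShortWord d n) := (List.finite_length_lt (Fin d) n).to_subtype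

/-- Truncation of a series. -/
def trunc (K : Type) [Field K] (d n : ℕ) : NCSeries K d →ₗ[K] (ShortWord d n → K) where
  toFun f w := f w.1
  map_add' _ _ := rfl
  map_smul' _ _ := rfl

theorem ker_trunc (n : ℕ) : LinearMap.ker (trunc K d n) = lowOrder K d n := by
  ext f
  rw [LinearMap.mem_ker]
  exact ⟨fun h w hw => congrFun h ⟨w, hw⟩, fun h => funext fun w => h w.1 w.2⟩

theorem finite_quotient {n : ℕ} {M : Submodule K (NCSeries K d)} (h : lowOrder K d n ≤ M) :
    Module.Finite K (NCSeries K d ⧸ M) := by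
  have : Module.Finite K (NCSeries K d ⧸ lowOrder K d n) := by
    rw [← ker_trunc]
    exact Module.Finite.equiv (trunc K d n).quotKerEquivRange.symm
  exact Module.Finite.of_surjective (Submodule.factor h) (Submodule.factor_surjective h)

/-- The two-sided ideal generated by a family of series. -/
def relSpan (ρ : ι → NCSeries K d) : Submodule K (NCSeries K d) :=
  Submodule.span K (Set.range fun z : NCSeries K d × ι × NCSeries K d => z.1 * ρ z.2.1 * z.2.2)

theorem mul_relator_mul_mem (ρ : ι → NCSeries K d) (x : NCSeries K d) (i : ι)
    (y : NCSeries K d) : x * ρ i * y ∈ relSpan ρ :=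
  Submodule.subset_span ⟨(x, i, y), rfl⟩

theorem mul_mem_relSpan_left (ρ : ι → NCSeries K d) (g : NCSeries K d) {f : NCSeries K d}
    (hf : f ∈ relSpan ρ) : g * f ∈ relSpan ρ := by
  change f ∈ (relSpan ρ).comap (LinearMap.mulLeft K g)
  refine (Submodule.span_le.2 ?_) hf
  rintro _ ⟨⟨x, i, y⟩, rfl⟩
  simpa [mul_assoc] using mul_relator_mul_mem ρ (g * x) i y

theorem mul_mem_relSpan_right (ρ : ι → NCSeries K d) (g : NCSeries K d) {f : NCSeries K d}
    (hf : f ∈ relSpan ρ) : f * g ∈ relSpan ρ := by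
  change f ∈ (relSpan ρ).comap (LinearMap.mulRight K g)
  refine (Submodule.span_le.2 ?_) hf
  rintro _ ⟨⟨x, i, y⟩, rfl⟩
  simpa [mul_assoc] using mul_relator_mul_mem ρ x i (y * g)

/-- The two-sided ideal generated by a family of series and the series of order at least `n`. -/
def relIdeal (ρ : ι → NCSeries K d) (n : ℕ) : Submodule K (NCSeries K d) :=
  relSpan ρ ⊔ lowOrder K d n

instance (ρ : ι → NCSeries K d) (n : ℕ) : Module.Finite K (NCSeries K d ⧸ relIdeal ρ n) :=
  finite_quotient le_sup_right

theorem mul_mem_relIdeal_left (ρ : ι → NCSeries K d) {n : ℕ} (g : NCSeries K d)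
    {f : NCSeries K d} (hf : f ∈ relIdeal ρ n) : g * f ∈ relIdeal ρ n := by
  obtain ⟨a, ha, b, hb, rfl⟩ := Submodule.mem_sup.1 hf
  rw [mul_add]
  exact Submodule.add_mem_sup (mul_mem_relSpan_left ρ g ha) (mul_mem_lowOrder_left g hb)

/-- The dimension of the quotient by the ideal `relIdeal ρ n`. -/
noncomputable def relDim (ρ : ι → NCSeries K d) (n : ℕ) : ℕ :=
  Module.finrank K (NCSeries K d ⧸ relIdeal ρ n)

theorem tail_mul (a : Fin d) (f g : NCSeries K d) :
    tail a (f * g) = f [] • tail a g + tail a f * g :=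
  ext' fun v => mul_cons f g a v

/-- The constant coefficient of a series together with the classes of its tails. -/
def splitHead (ρ : ι → NCSeries K d) (n : ℕ) :
    NCSeries K d →ₗ[K] K × (Fin d → NCSeries K d ⧸ relIdeal ρ n) where
  toFun f := (f [], fun a => (relIdeal ρ n).mkQ (tail a f))
  map_add' _ _ := rfl
  map_smul' _ _ := rfl

theorem splitHead_surjective (ρ : ι → NCSeries K d) (n : ℕ) :
    Function.Surjective (splitHead ρ n) := by
  rintro ⟨c, v⟩
  choose g hg using fun a => (relIdeal ρ n).mkQ_surjective (v a)
  let f : NCSeries K d := fun w => match w with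
    | [] => c
    | a :: w => g a w
  exact ⟨f, Prod.ext rfl (funext hg)⟩

theorem mem_ker_splitHead {ρ : ι → NCSeries K d} {n : ℕ} {f : NCSeries K d} :
    f ∈ LinearMap.ker (splitHead ρ n) ↔ f [] = 0 ∧ ∀ a, tail a f ∈ relIdeal ρ n := by
  rw [LinearMap.mem_ker]
  simp only [splitHead, LinearMap.coe_mk, AddHom.coe_mk, Prod.ext_iff, funext_iff,
    Submodule.mkQ_apply, Prod.fst_zero, Prod.snd_zero, Pi.zero_apply,
    Submodule.Quotient.mk_eq_zero]

theorem lowOrder_le_ker_splitHead (ρ : ι → NCSeries K d) (n : ℕ) :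
    lowOrder K d (n + 1) ≤ LinearMap.ker (splitHead ρ n) := fun f hf =>
  mem_ker_splitHead.2 ⟨hf [] (by simp), fun a => Submodule.mem_sup_right fun w hw =>
    hf (a :: w) (by simpa using hw)⟩

theorem mul_mem_ker_splitHead {ρ : ι → NCSeries K d} {n : ℕ} {r f : NCSeries K d}
    (hr : r [] = 0) (hf : f ∈ relIdeal ρ n) : r * f ∈ LinearMap.ker (splitHead ρ n) :=
  mem_ker_splitHead.2 ⟨by rw [mul_nil, hr, zero_mul], fun a => by
    rw [tail_mul, hr, zero_smul, zero_add]
    exact mul_mem_relIdeal_left ρ _ hf⟩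

theorem finrank_quotient_ker_splitHead (ρ : ι → NCSeries K d) (n : ℕ) :
    Module.finrank K (NCSeries K d ⧸ LinearMap.ker (splitHead ρ n)) = 1 + d * relDim ρ n := by
  rw [((splitHead ρ n).quotKerEquivOfSurjective (splitHead_surjective ρ n)).finrank_eq,
    Module.finrank_prod, Module.finrank_self, Module.finrank_pi_fintype]
  simp [relDim]

/-- The cokernel of `φ` is a quotient of `V ⧸ M`, since the image of `M` is absorbed by the range of
`φ`. -/
theorem finrank_le_of_quotient {V W : Type*} [AddCommGroup V] [Module K V] [AddCommGroup W]
    [Module K W] {L M : Submodule K V} [Module.Finite K (V ⧸ L)] [Module.Finite K (V ⧸ M)]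
    [Module.Finite K W] (φ : W →ₗ[K] V ⧸ L) (h : M ≤ (LinearMap.range φ).comap L.mkQ) :
    Module.finrank K (V ⧸ L) ≤ Module.finrank K (V ⧸ M) + Module.finrank K W := by
  rw [← Submodule.finrank_quotient_add_finrank (LinearMap.range φ)]
  refine add_le_add ?_ (LinearMap.finrank_range_le φ)
  refine LinearMap.finrank_le_finrank_of_surjective
    (f := M.liftQ ((LinearMap.range φ).mkQ ∘ₗ L.mkQ) ?_) ?_
  · rwa [LinearMap.ker_comp, Submodule.ker_mkQ]
  · rw [← LinearMap.range_eq_top, Submodule.range_liftQ, LinearMap.range_eq_top]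
    exact (Submodule.mkQ_surjective _).comp (Submodule.mkQ_surjective _)

/-- Left multiplication by a series of order at least `m`, modulo the kernel of `splitHead`. -/
def mulRel (ρ : ι → NCSeries K d) (n : ℕ) (r : NCSeries K d) {m : ℕ}
    (hr : r ∈ lowOrder K d (m + 1)) : (NCSeries K d ⧸ relIdeal ρ (n - m)) →ₗ[K]
      NCSeries K d ⧸ LinearMap.ker (splitHead ρ n) :=
  (relIdeal ρ (n - m)).liftQ ((LinearMap.ker (splitHead ρ n)).mkQ ∘ₗ LinearMap.mulLeft K r) <| by
    intro f hf
    rw [LinearMap.mem_ker, LinearMap.comp_apply, Submodule.mkQ_apply,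
      Submodule.Quotient.mk_eq_zero, LinearMap.mulLeft_apply]
    have hr0 : r [] = 0 := hr [] (by simp)
    obtain ⟨a, ha, b, hb, rfl⟩ := Submodule.mem_sup.1 hf
    rw [mul_add]
    refine Submodule.add_mem _ (mul_mem_ker_splitHead hr0 (Submodule.mem_sup_left ha)) ?_
    -- The product has order at least `(m + 1) + (n - m) ≥ n + 1`. This also covers `m > n`, where
    -- the truncated difference is 0.
    exact lowOrder_le_ker_splitHead ρ n
      (lowOrder_antitone (by omega) (mul_mem_lowOrder_add hr hb))

/-- The Golod–Shafarevich inequality: `s` contains the indices of all relators of order at most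
`n`, and the `i`-th relator has order at least `deg i + 1`. -/
theorem one_add_mul_relDim_le (ρ : ι → NCSeries K d) (deg : ι → ℕ) (n : ℕ) (s : Finset ι)
    (hdeg : ∀ i, ρ i ∈ lowOrder K d (deg i + 1))
    (hs : ∀ i, i ∉ s → ρ i ∈ lowOrder K d (n + 1)) :
    1 + d * relDim ρ n ≤ relDim ρ (n + 1) + ∑ i ∈ s, relDim ρ (n - deg i) := by
  classical
  have hfin := finite_quotient (lowOrder_le_ker_splitHead ρ n)
  let φ : (∀ i : s, NCSeries K d ⧸ relIdeal ρ (n - deg i)) →ₗ[K]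
      NCSeries K d ⧸ LinearMap.ker (splitHead ρ n) :=
    LinearMap.lsum K _ K fun i : s => mulRel ρ n (ρ i) (hdeg i)
  have key : relIdeal ρ (n + 1) ≤
      (LinearMap.range φ).comap (LinearMap.ker (splitHead ρ n)).mkQ := by
    have h0 : LinearMap.ker (splitHead ρ n) ≤
        (LinearMap.range φ).comap (LinearMap.ker (splitHead ρ n)).mkQ := by
      intro f hf
      rw [Submodule.mem_comap, Submodule.mkQ_apply, (Submodule.Quotient.mk_eq_zero _).2 hf]
      exact Submodule.zero_mem _
    refine sup_le (Submodule.span_le.2 ?_) ((lowOrder_le_ker_splitHead ρ n).trans h0)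
    rintro _ ⟨⟨x, i, y⟩, rfl⟩
    have hnil : ρ i [] = 0 := hdeg i [] (by simp)
    -- The kernel of `splitHead` is `I * relIdeal ρ n`. Modulo it only the constant term of the left
    -- factor matters, so the right multiples `ρ i * y` suffice to generate.
    have h1 : x * ρ i * y - x [] • (ρ i * y) ∈ LinearMap.ker (splitHead ρ n) := by
      refine mem_ker_splitHead.2 ⟨?_, fun a => Submodule.mem_sup_left ?_⟩
      · simp [sub_apply, smul_apply, mul_nil, hnil]
      · have e : tail a (x * ρ i * y - x [] • (ρ i * y)) = tail a x * ρ i * y := by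
          have : tail a (x * ρ i * y - x [] • (ρ i * y)) =
            tail a (x * (ρ i * y)) - x [] • tail a (ρ i * y) := by rw [mul_assoc]; rfl
          rw [this, tail_mul, add_sub_cancel_left, mul_assoc]
        rw [e]
        exact mul_relator_mul_mem ρ _ i y
    have h2 : ρ i * y ∈ (LinearMap.range φ).comap (LinearMap.ker (splitHead ρ n)).mkQ := by
      by_cases hi : i ∈ s
      · refine ⟨Pi.single ⟨i, hi⟩ ((relIdeal ρ (n - deg i)).mkQ y), ?_⟩
        rw [LinearMap.lsum_piSingle]
        rfl
      · exact h0 (lowOrder_le_ker_splitHead ρ n (mul_mem_lowOrder_right (hs i hi) y))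
    have := Submodule.add_mem _ (h0 h1) (Submodule.smul_mem _ (x []) h2)
    rwa [sub_add_cancel] at this
  have := finrank_le_of_quotient φ key
  rw [finrank_quotient_ker_splitHead, Module.finrank_pi_fintype] at this
  refine this.trans_eq ?_
  congr 1
  exact Finset.sum_coe_sort s fun i => relDim ρ (n - deg i)

end LinearStructure

end NCSeries

/-! ### Spanning the series ring modulo powers of the augmentation ideal. -/

namespace NCSeries

variable {K : Type} [Field K] {d : ℕ}

theorem eq_smul_one_add_sum (f : NCSeries K d) :
    f = f [] • (1 : NCSeries K d) + ∑ a, X K a * tail a f := by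
  have hsum : ∀ (s : Finset (Fin d)) (g : Fin d → NCSeries K d) (w : List (Fin d)),
      (∑ a ∈ s, g a) w = ∑ a ∈ s, g a w := fun s g w => Finset.sum_apply w s g
  apply ext'
  intro w
  rw [add_apply, smul_apply, one_apply, hsum]
  cases w with
  | nil => simp [X_mul_nil]
  | cons b w => simp [X_mul_cons, tail]

/-- `P` is stable under left multiplication by each `u_a = (1 + u_a) - 1`, so it contains all
monomials. It will be applied to the span of the Magnus image of the free group. -/
theorem sup_lowOrder_eq_top (P : Submodule K (NCSeries K d)) (h1 : 1 ∈ P)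
    (hX : ∀ a, ∀ f ∈ P, (1 + X K a) * f ∈ P) (n : ℕ) : P ⊔ lowOrder K d n = ⊤ := by
  induction n with
  | zero => exact top_le_iff.1 fun f _ => Submodule.mem_sup_right (mem_lowOrder_zero f)
  | succ n ih =>
    refine top_le_iff.1 fun f _ => ?_
    rw [eq_smul_one_add_sum f]
    refine Submodule.add_mem _ (Submodule.mem_sup_left (P.smul_mem _ h1))
      (Submodule.sum_mem _ fun a _ => ?_)
    obtain ⟨g, hg, l, hl, e⟩ := Submodule.mem_sup.1 (ih ▸ Submodule.mem_top : tail a f ∈ _)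
    rw [← e, mul_add]
    refine Submodule.add_mem_sup ?_ ?_
    · have := P.sub_mem (hX a g hg) hg
      rwa [add_mul, one_mul, add_sub_cancel_left] at this
    · have hXa : X K a ∈ lowOrder K d 1 := fun w hw => by
        have : w = [] := List.length_eq_zero_iff.1 (by omega)
        simp [X, this]
      rw [add_comm n 1]
      exact mul_mem_lowOrder_add hXa hl

end NCSeries

open NCSeries

/-! ### Growth forced by a negative value of the series. -/

theorem sum_convolution_le {f g : ℕ → ℝ} (hf : ∀ i, 0 ≤ f i) (hg : ∀ i, 0 ≤ g i) (N : ℕ) :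
    ∑ n ∈ Finset.range N, ∑ i ∈ Finset.range (n + 1), f i * g (n - i) ≤
      (∑ i ∈ Finset.range N, f i) * ∑ j ∈ Finset.range N, g j := by
  rw [Finset.sum_comm' (t' := Finset.range N) (s' := fun i => Finset.Ico i N)
    (by intro x y; simp only [Finset.mem_range, Finset.mem_Ico]; omega), Finset.sum_mul]
  refine Finset.sum_le_sum fun i _ => ?_
  rw [← Finset.mul_sum, Finset.sum_Ico_eq_sum_range]
  refine mul_le_mul_of_nonneg_left ?_ (hf i)
  simp only [Nat.add_sub_cancel_left]
  exact Finset.sum_le_sum_of_subset_of_nonneg (Finset.range_mono (Nat.sub_le _ _))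
    fun j _ _ => hg j

/-- A sequence that satisfies the Golod–Shafarevich inequality for a series with a negative value
is unbounded. -/
theorem unbounded_of_golodShafarevich (a c : ℕ → ℕ) (m : ℕ)
    (hrec : ∀ n, 1 + m * a n ≤ a (n + 1) + ∑ i ∈ Finset.range (n + 1), c i * a (n - i))
    {t : ℝ} (ht0 : 0 < t) (ht1 : t < 1) (hsum : Summable fun i => (c i : ℝ) * t ^ (i + 1))
    (hneg : 1 - (m : ℝ) * t + ∑' i, (c i : ℝ) * t ^ (i + 1) < 0) (b : ℕ) :
    ∃ n, b < a n := by
  by_contra! hb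
  -- If `a ≤ b`, this `N` makes the boundary term `a N * t ^ N` smaller than `t`. Summing the
  -- recursion, weighted by `t ^ (n + 1)`, over `n < N` gives `t + m * t * A ≤ A + a N * t ^ N + H *
  -- A`. This is impossible, because `1 - m * t + H < 0` and `A ≥ 0`.
  obtain ⟨N, hN⟩ := exists_pow_lt_of_lt_one (show 0 < t / (b + 1) by positivity) ht1
  have hN0 : N ≠ 0 := by
    rintro rfl
    rw [pow_zero, lt_div_iff₀ (by positivity)] at hN
    have : (0 : ℝ) ≤ b := b.cast_nonneg
    linarith
  set H := ∑' i, (c i : ℝ) * t ^ (i + 1)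
  set A := ∑ n ∈ Finset.range N, (a n : ℝ) * t ^ n
  have hA : 0 ≤ A := Finset.sum_nonneg fun n _ => by positivity
  have h1 : t ≤ ∑ n ∈ Finset.range N, t ^ (n + 1) := by
    have := Finset.single_le_sum (f := fun n => t ^ (n + 1)) (fun n _ => by positivity)
      (Finset.mem_range.2 (Nat.pos_of_ne_zero hN0))
    simpa using this
  have h2 : ∑ n ∈ Finset.range N, (a (n + 1) : ℝ) * t ^ (n + 1) ≤ A + a N * t ^ N := by
    have e := Finset.sum_range_succ' (fun n => (a n : ℝ) * t ^ n) N
    rw [Finset.sum_range_succ] at e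
    have : 0 ≤ (a 0 : ℝ) * t ^ 0 := by positivity
    linarith
  have h3 : ∑ n ∈ Finset.range N, ∑ i ∈ Finset.range (n + 1),
      ((c i : ℝ) * t ^ (i + 1)) * (a (n - i) * t ^ (n - i)) ≤ H * A := by
    refine (sum_convolution_le (fun i => by positivity)
      (g := fun j => (a j : ℝ) * t ^ j) (fun i => by positivity) N).trans ?_
    exact mul_le_mul_of_nonneg_right (hsum.sum_le_tsum _ fun i _ => by positivity) hA
  have h4 : ∑ n ∈ Finset.range N, (t ^ (n + 1) + m * t * (a n * t ^ n)) ≤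
      ∑ n ∈ Finset.range N, ((a (n + 1) : ℝ) * t ^ (n + 1) + ∑ i ∈ Finset.range (n + 1),
        ((c i : ℝ) * t ^ (i + 1)) * (a (n - i) * t ^ (n - i))) := by
    refine Finset.sum_le_sum fun n _ => ?_
    have hn : (1 : ℝ) + m * a n ≤ a (n + 1) + ∑ i ∈ Finset.range (n + 1),
        (c i : ℝ) * a (n - i) := by exact_mod_cast hrec n
    have := mul_le_mul_of_nonneg_right hn (show 0 ≤ t ^ (n + 1) by positivity)
    calc t ^ (n + 1) + m * t * (a n * t ^ n) = (1 + m * a n) * t ^ (n + 1) := by ring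
      _ ≤ _ := this
      _ = _ := by
        rw [add_mul, Finset.sum_mul]
        congr 1
        refine Finset.sum_congr rfl fun i hi => ?_
        have e : n + 1 = (i + 1) + (n - i) := by have := Finset.mem_range.1 hi; omega
        rw [e, pow_add t (i + 1)]
        ring
  rw [Finset.sum_add_distrib, Finset.sum_add_distrib, ← Finset.mul_sum] at h4
  have h5 : (a N : ℝ) * t ^ N < t := by
    rw [lt_div_iff₀ (by positivity)] at hN
    have hbN : (a N : ℝ) ≤ b := by exact_mod_cast hb N
    have := pow_pos ht0 N
    nlinarith
  nlinarith

/-! ### The Golod–Shafarevich theorem for group presentations. -/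

section Magnus

variable {p d : ℕ}

/-- The series `π(f)`, where `π` is the Magnus embedding. -/
def magnusSeries (p : ℕ) {d : ℕ} (f : FreeGroup (Fin d)) : NCSeries (ZMod p) d :=
  (magnus p d f : NCSeries (ZMod p) d)

theorem magnusSeries_mul (f g : FreeGroup (Fin d)) :
    magnusSeries p (f * g) = magnusSeries p f * magnusSeries p g := by
  simp [magnusSeries]

theorem magnusSeries_one : magnusSeries p (1 : FreeGroup (Fin d)) = 1 := by
  simp [magnusSeries]

theorem magnusSeries_of (i : Fin d) : magnusSeries p (FreeGroup.of i) = 1 + X (ZMod p) i := by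
  simp [magnusSeries, magnus, oneAddX]

theorem magnusSeries_inv_mul (f : FreeGroup (Fin d)) :
    magnusSeries p f⁻¹ * magnusSeries p f = 1 := by
  rw [← magnusSeries_mul, inv_mul_cancel, magnusSeries_one]

theorem magnusSeries_mul_inv (f : FreeGroup (Fin d)) :
    magnusSeries p f * magnusSeries p f⁻¹ = 1 := by
  rw [← magnusSeries_mul, mul_inv_cancel, magnusSeries_one]

theorem magnusSeries_nil (f : FreeGroup (Fin d)) : magnusSeries p f [] = 1 := by
  induction f using FreeGroup.induction_on with
  | C1 => rw [magnusSeries_one]; rfl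
  | of i => simp [magnusSeries_of, NCSeries.add_apply, NCSeries.one_apply, X]
  | inv_of i h =>
    have := congrFun (magnusSeries_inv_mul (p := p) (FreeGroup.of i)) []
    rw [mul_nil, h, mul_one] at this
    exact this
  | mul x y hx hy => rw [magnusSeries_mul, mul_nil, hx, hy, mul_one]

variable [Fact p.Prime]

theorem mem_zassenhaus {n : ℕ} {f : FreeGroup (Fin d)} :
    f ∈ zassenhaus p d n ↔ magnusSeries p f - 1 ∈ lowOrder (ZMod p) d n := Iff.rfl

theorem mem_zassenhaus_one (f : FreeGroup (Fin d)) : f ∈ zassenhaus p d 1 := fun w hw => by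
  have : w = [] := List.length_eq_zero_iff.1 (by omega)
  subst this
  change magnusSeries p f [] - 1 = 0
  rw [magnusSeries_nil, sub_self]

theorem zassenhaus_antitone {m n : ℕ} (h : m ≤ n) : zassenhaus p d n ⊆ zassenhaus p d m :=
  fun _ hf => lowOrder_antitone h hf

/-- `degPred p f + 1` is the degree of `f` (if the degree is finite). -/
noncomputable def degPred (p : ℕ) {d : ℕ} (f : FreeGroup (Fin d)) : ℕ :=
  sInf {k | f ∉ zassenhaus p d (k + 2)}

/-- If `f` lies in every term of the filtration, the infimum is over the empty set and equals 0. The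
claim is then still true, so injectivity of the Magnus map is never needed. -/
theorem mem_zassenhaus_degPred (f : FreeGroup (Fin d)) :
    f ∈ zassenhaus p d (degPred p f + 1) := by
  rcases h : degPred p f with _ | k
  · exact mem_zassenhaus_one f
  · by_contra hk
    have := Nat.sInf_le (s := {k | f ∉ zassenhaus p d (k + 2)}) hk
    rw [← degPred, h] at this
    omega

theorem degPred_eq {S : Set (FreeGroup (Fin d))} {i : ℕ} {f : FreeGroup (Fin d)}
    (hf : f ∈ relatorsOfDegree p S (i + 1)) : degPred p f = i := by
  refine le_antisymm (Nat.sInf_le hf.2.2) (le_csInf ⟨i, hf.2.2⟩ fun k hk => ?_)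
  by_contra! hlt
  exact hk (zassenhaus_antitone (by omega) hf.2.1)

theorem mem_relatorsOfDegree_degPred {S : Set (FreeGroup (Fin d))} {n : ℕ}
    {f : FreeGroup (Fin d)} (hS : f ∈ S) (hf : f ∉ zassenhaus p d (n + 1)) :
    degPred p f < n ∧ f ∈ relatorsOfDegree p S (degPred p f + 1) := by
  have hn : n ≠ 0 := fun h => hf (h ▸ mem_zassenhaus_one f)
  have hmem : n - 1 ∈ {k | f ∉ zassenhaus p d (k + 2)} := by
    have : n - 1 + 2 = n + 1 := by omega
    change f ∉ zassenhaus p d (n - 1 + 2)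
    rwa [this]
  refine ⟨?_, hS, mem_zassenhaus_degPred f, ?_⟩
  · have : degPred p f ≤ n - 1 := Nat.sInf_le hmem
    omega
  · exact Nat.sInf_mem ⟨_, hmem⟩

/-- The series `π(r) - 1` for the relators `r`. -/
def relatorSeries (p : ℕ) {d : ℕ} (S : Set (FreeGroup (Fin d))) (r : S) : NCSeries (ZMod p) d :=
  magnusSeries p r.1 - 1

/-- The general inequality is applied to the finitely many relators of degree at most `n + 1`,
grouped by degree. Every other relator lies in the `(n + 1)`-st Zassenhaus term. -/
theorem one_add_mul_relDim_relatorSeries_le (S : Set (FreeGroup (Fin d)))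
    (hfin : ∀ i : ℕ, (relatorsOfDegree p S (i + 1)).Finite) (n : ℕ) :
    1 + d * relDim (relatorSeries p S) n ≤ relDim (relatorSeries p S) (n + 1) +
      ∑ i ∈ Finset.range (n + 1), (relatorsOfDegree p S (i + 1)).ncard *
        relDim (relatorSeries p S) (n - i) := by
  classical
  have hfin' : {r : S | r.1 ∈ ⋃ i ∈ Finset.range (n + 1),
      relatorsOfDegree p S (i + 1)}.Finite :=
    Set.Finite.preimage Subtype.val_injective.injOn
      ((Finset.range (n + 1)).finite_toSet.biUnion fun i _ => hfin i)
  refine (one_add_mul_relDim_le (relatorSeries p S) (fun r => degPred p r.1) n hfin'.toFinset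
    (fun r => mem_zassenhaus_degPred r.1) fun r hr => ?_).trans (Nat.add_le_add_left ?_ _)
  · by_contra h
    obtain ⟨h1, h2⟩ := mem_relatorsOfDegree_degPred r.2 h
    refine hr (hfin'.mem_toFinset.2 ?_)
    exact Set.mem_biUnion (Finset.mem_coe.2 (Finset.mem_range.2 (h1.trans (Nat.lt_succ_self n))))
      h2
  · have hmem : ∀ r ∈ hfin'.toFinset, degPred p r.1 ∈ Finset.range (n + 1) ∧
        r.1 ∈ relatorsOfDegree p S (degPred p r.1 + 1) := by
      intro r hr
      obtain ⟨i, hi, h⟩ := Set.mem_iUnion₂.1 (hfin'.mem_toFinset.1 hr)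
      rw [degPred_eq h]
      exact ⟨hi, h⟩
    rw [← Finset.sum_fiberwise_of_maps_to (fun r hr => (hmem r hr).1)]
    refine Finset.sum_le_sum fun i _ => ?_
    rw [Finset.sum_congr rfl (g := fun _ => relDim (relatorSeries p S) (n - i))
      (fun r hr => by rw [(Finset.mem_filter.1 hr).2]), Finset.sum_const, smul_eq_mul]
    refine Nat.mul_le_mul_right _ ?_
    rw [Set.ncard_eq_toFinset_card _ (hfin i)]
    refine Finset.card_le_card_of_injOn Subtype.val (fun r hr => ?_) Subtype.val_injective.injOn
    obtain ⟨h1, h2⟩ := Finset.mem_filter.1 hr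
    rw [Finset.mem_coe, Set.Finite.mem_toFinset]
    exact h2 ▸ (hmem r h1).2

/-- The elements congruent to 1 modulo a two-sided ideal form a normal subgroup, and this one
contains `S`. -/
theorem magnusSeries_sub_one_mem_relSpan (S : Set (FreeGroup (Fin d))) {f : FreeGroup (Fin d)}
    (hf : f ∈ Subgroup.normalClosure S) :
    magnusSeries p f - 1 ∈ relSpan (relatorSeries p S) := by
  have hmul : ∀ {f g : FreeGroup (Fin d)}, magnusSeries p f - 1 ∈ relSpan (relatorSeries p S) →
      magnusSeries p g - 1 ∈ relSpan (relatorSeries p S) →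
      magnusSeries p (f * g) - 1 ∈ relSpan (relatorSeries p S) := by
    intro f g hf hg
    have e : magnusSeries p (f * g) - 1 =
        magnusSeries p f * (magnusSeries p g - 1) + (magnusSeries p f - 1) := by
      rw [magnusSeries_mul, mul_sub, mul_one, sub_add_sub_cancel]
    rw [e]
    exact Submodule.add_mem _ (mul_mem_relSpan_left _ _ hg) hf
  have hN : ∀ g : FreeGroup (Fin d), magnusSeries p g - 1 ∈ relSpan (relatorSeries p S) →
      magnusSeries p g⁻¹ - 1 ∈ relSpan (relatorSeries p S) := by
    intro g hg
    have e : magnusSeries p g⁻¹ - 1 = -(magnusSeries p g⁻¹ * (magnusSeries p g - 1)) := by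
      rw [mul_sub, magnusSeries_inv_mul, mul_one, neg_sub]
    rw [e]
    exact Submodule.neg_mem _ (mul_mem_relSpan_left _ _ hg)
  let N : Subgroup (FreeGroup (Fin d)) :=
    { carrier := {g | magnusSeries p g - 1 ∈ relSpan (relatorSeries p S)}
      mul_mem' := hmul
      one_mem' := by simp [magnusSeries_one]
      inv_mem' := fun {g} hg => hN g hg }
  have : N.Normal := ⟨fun g hg h => by
    change magnusSeries p (h * g * h⁻¹) - 1 ∈ relSpan (relatorSeries p S)
    have e : magnusSeries p (h * g * h⁻¹) - 1 =
        magnusSeries p h * (magnusSeries p g - 1) * magnusSeries p h⁻¹ := by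
      rw [magnusSeries_mul, magnusSeries_mul, mul_sub, sub_mul, mul_one, magnusSeries_mul_inv]
    rw [e]
    exact mul_mem_relSpan_right _ _ (mul_mem_relSpan_left _ _ hg)⟩
  refine Subgroup.normalClosure_le_normal (N := N) (fun r hr => ?_) hf
  have := mul_relator_mul_mem (relatorSeries p S) 1 ⟨r, hr⟩ 1
  rwa [one_mul, mul_one] at this

/-- Modulo the ideal, `π(f)` depends only on the class of `f` in the presented group. These images
span the quotient, because the Magnus image spans the series ring modulo `I ^ n`. -/
theorem relDim_relatorSeries_le_card (S : Set (FreeGroup (Fin d))) [Finite (PresentedGroup S)]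
    (n : ℕ) : relDim (relatorSeries p S) n ≤ Nat.card (PresentedGroup S) := by
  have := Fintype.ofFinite (PresentedGroup S)
  rw [Nat.card_eq_fintype_card]
  let v : PresentedGroup S → NCSeries (ZMod p) d ⧸ relIdeal (relatorSeries p S) n :=
    fun g => (relIdeal (relatorSeries p S) n).mkQ (magnusSeries p (Quotient.out g))
  have hv : ∀ f : FreeGroup (Fin d),
      (relIdeal (relatorSeries p S) n).mkQ (magnusSeries p f) ∈ Set.range v := by
    intro f
    refine ⟨QuotientGroup.mk f, ?_⟩
    set g : FreeGroup (Fin d) := Quotient.out (QuotientGroup.mk f : PresentedGroup S) with hg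
    have hgf : f⁻¹ * g ∈ Subgroup.normalClosure S := by
      rw [← QuotientGroup.eq]
      exact (Quotient.out_eq _).symm
    change (relIdeal (relatorSeries p S) n).mkQ (magnusSeries p g) = _
    rw [Submodule.mkQ_apply, Submodule.mkQ_apply, Submodule.Quotient.eq]
    have e : magnusSeries p g - magnusSeries p f =
        magnusSeries p f * (magnusSeries p (f⁻¹ * g) - 1) := by
      rw [mul_sub, ← magnusSeries_mul, mul_inv_cancel_left, mul_one]
    rw [e]
    exact Submodule.mem_sup_left
      (mul_mem_relSpan_left _ _ (magnusSeries_sub_one_mem_relSpan S hgf))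
  have htop : Submodule.span (ZMod p) (Set.range v) = ⊤ := by
    let P : Submodule (ZMod p) (NCSeries (ZMod p) d) :=
      Submodule.span (ZMod p) (Set.range (magnusSeries p))
    have hP : P ⊔ lowOrder (ZMod p) d n = ⊤ := by
      refine sup_lowOrder_eq_top P ?_ ?_ n
      · exact Submodule.subset_span ⟨1, magnusSeries_one⟩
      · intro a f hf
        change f ∈ P.comap (LinearMap.mulLeft (ZMod p) (1 + X (ZMod p) a))
        refine Submodule.span_le.2 ?_ hf
        rintro _ ⟨g, rfl⟩
        exact Submodule.subset_span ⟨FreeGroup.of a * g, by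
          rw [magnusSeries_mul, magnusSeries_of]; rfl⟩
    refine top_le_iff.1 fun x _ => ?_
    obtain ⟨f, rfl⟩ := Submodule.mkQ_surjective _ x
    obtain ⟨g, hg, l, hl, rfl⟩ := Submodule.mem_sup.1 (hP ▸ Submodule.mem_top : f ∈ _)
    have hl0 : (relIdeal (relatorSeries p S) n).mkQ l = 0 :=
      (Submodule.Quotient.mk_eq_zero _).2 (Submodule.mem_sup_right hl)
    rw [map_add, hl0, add_zero]
    change g ∈ (Submodule.span (ZMod p) (Set.range v)).comap
      (relIdeal (relatorSeries p S) n).mkQ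
    refine Submodule.span_le.2 ?_ hg
    rintro _ ⟨h, rfl⟩
    exact Submodule.subset_span (hv h)
  have := finrank_range_le_card (R := ZMod p) v
  rwa [Set.finrank, htop, finrank_top] at this

/-- The Golod–Shafarevich theorem. -/
theorem infinite_of_golodShafarevich (S : Set (FreeGroup (Fin d)))
    (hfin : ∀ i : ℕ, (relatorsOfDegree p S (i + 1)).Finite) {t : ℝ} (ht0 : 0 < t) (ht1 : t < 1)
    (hsum : Summable fun i : ℕ => ((relatorsOfDegree p S (i + 1)).ncard : ℝ) * t ^ (i + 1))
    (hneg : 1 - (d : ℝ) * t +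
      ∑' i : ℕ, ((relatorsOfDegree p S (i + 1)).ncard : ℝ) * t ^ (i + 1) < 0) :
    Infinite (PresentedGroup S) := by
  by_contra h
  have := not_infinite_iff_finite.1 h
  obtain ⟨n, hn⟩ := unbounded_of_golodShafarevich (relDim (relatorSeries p S)) _ d
    (one_add_mul_relDim_relatorSeries_le S hfin) ht0 ht1 hsum hneg (Nat.card (PresentedGroup S))
  exact absurd (relDim_relatorSeries_le_card S n) (not_le.2 hn)

end Magnus


/-! ### The minimal number of generators of the pro-`p` completion -/

section TopRank

variable {p : ℕ}

theorem PowIndexSubgroup.isPGroup_pQuotient {G : Type*} [Group G] (N : PowIndexSubgroup p G) :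
    IsPGroup p (PQuotient N) := by
  obtain ⟨k, hk⟩ := N.index_eq
  exact IsPGroup.of_card (p := p) (G := G ⧸ N.toSubgroup) hk

theorem pQuotient_discrete {G : Type*} [Group G] (N : PowIndexSubgroup p G) :
    DiscreteTopology (PQuotient N) := ⟨rfl⟩

variable [Fact p.Prime]

/-- A maximal subgroup of a finite `p`-group is normal of index `p`, so the quotient by one that
contains `H` is the required character. -/
theorem exists_character_of_ne_top {Q : Type*} [Group Q] [Finite Q] (hQ : IsPGroup p Q)
    {H : Subgroup Q} (hH : H ≠ ⊤) :
    ∃ χ : Q →* Multiplicative (ZMod p), χ ≠ 1 ∧ H ≤ χ.ker := by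
  obtain ⟨M, hM, hHM⟩ := (eq_top_or_exists_le_coatom H).resolve_left hH
  have := hQ.isNilpotent
  have hMn : M.Normal := Subgroup.NormalizerCondition.normal_of_coatom M
    Group.normalizerCondition_of_isNilpotent hM
  have hnt : Nontrivial (Q ⧸ M) := QuotientGroup.nontrivial_iff.2 hM.1
  have hdvd : p ∣ Nat.card (Q ⧸ M) := (hQ.to_quotient M).card_eq_or_dvd.resolve_left
    (Finite.one_lt_card (α := Q ⧸ M)).ne'
  obtain ⟨g, hg⟩ := exists_prime_orderOf_dvd_card' p hdvd
  have hg1 : g ≠ 1 := fun h => (Fact.out : p.Prime).one_lt.ne (by rw [← hg, h, orderOf_one])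
  -- By maximality of `M` the preimage of the subgroup generated by `g` is everything, so `Q ⧸ M` is
  -- cyclic of order `p`.
  have hlt : M < (Subgroup.zpowers g).comap (QuotientGroup.mk' M) := by
    refine lt_of_le_of_ne (fun x hx => ?_) fun h => hg1 ?_
    · rw [Subgroup.mem_comap, QuotientGroup.mk'_apply, (QuotientGroup.eq_one_iff x).2 hx]
      exact Subgroup.one_mem _
    · obtain ⟨x, rfl⟩ := QuotientGroup.mk'_surjective M g
      rw [QuotientGroup.mk'_apply, QuotientGroup.eq_one_iff, h]
      exact Subgroup.mem_zpowers _
  have htop := hM.2 _ hlt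
  have hgen : ∀ x : Q ⧸ M, x ∈ Subgroup.zpowers g := by
    intro x
    obtain ⟨y, rfl⟩ := QuotientGroup.mk'_surjective M x
    have : y ∈ (Subgroup.zpowers g).comap (QuotientGroup.mk' M) := htop ▸ Subgroup.mem_top y
    exact this
  have hcard : Nat.card (Q ⧸ M) = p := by rw [← hg, orderOf_eq_card_of_forall_mem_zpowers hgen]
  let e := (zmodMulEquivOfGenerator hgen hcard).symm
  refine ⟨e.toMonoidHom.comp (QuotientGroup.mk' M), fun h => hg1 ?_, fun x hx => ?_⟩
  · obtain ⟨x, rfl⟩ := QuotientGroup.mk'_surjective M g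
    exact e.map_eq_one_iff.1 (DFunLike.congr_fun h x)
  · rw [MonoidHom.mem_ker, MonoidHom.comp_apply, QuotientGroup.mk'_apply,
      (QuotientGroup.eq_one_iff x).2 (hHM hx), map_one]

/-- A family that is killed by no nontrivial character to `ℤ/p` generates every finite
`p`-quotient. -/
theorem closure_sup_eq_top {G : Type*} [Group G] {ι : Type*} (s : ι → G)
    (hs : ∀ χ : G →* Multiplicative (ZMod p), (∀ i, χ (s i) = 1) → χ = 1)
    (N : PowIndexSubgroup p G) : Subgroup.closure (Set.range s) ⊔ N.toSubgroup = ⊤ := by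
  obtain ⟨k, hk⟩ := N.index_eq
  have hfin : N.toSubgroup.FiniteIndex := ⟨by
    rw [hk]; exact pow_ne_zero _ (Fact.out : p.Prime).ne_zero⟩
  by_contra h
  have hne : (Subgroup.closure (Set.range s)).map (QuotientGroup.mk' N.toSubgroup) ≠ ⊤ := by
    intro e
    apply h
    rw [← QuotientGroup.ker_mk' N.toSubgroup, ← Subgroup.comap_map_eq, e, Subgroup.comap_top]
  obtain ⟨χ, hχ, hker⟩ := exists_character_of_ne_top
    (IsPGroup.of_card (p := p) (G := G ⧸ N.toSubgroup) hk) hne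
  have := hs (χ.comp (QuotientGroup.mk' N.toSubgroup)) fun i =>
    hker (Subgroup.mem_map_of_mem _ (Subgroup.subset_closure ⟨i, rfl⟩))
  refine hχ (MonoidHom.ext fun x => ?_)
  obtain ⟨y, rfl⟩ := QuotientGroup.mk'_surjective N.toSubgroup x
  exact DFunLike.congr_fun this y

/-- The kernel of a homomorphism to a finite `p`-group. -/
def PowIndexSubgroup.ofKer {G P : Type*} [Group G] [Group P] [Finite P] (hP : IsPGroup p P)
    (φ : G →* P) : PowIndexSubgroup p G where
  toSubgroup := φ.ker
  normal := inferInstance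
  index_eq := by
    rw [Subgroup.index_ker]
    exact IsPGroup.iff_card.1 (hP.to_subgroup φ.range)

theorem isPGroup_pi {ι : Type*} [Finite ι] {P : ι → Type*} [∀ i, Group (P i)]
    [∀ i, Finite (P i)] (hP : ∀ i, IsPGroup p (P i)) : IsPGroup p (∀ i, P i) := by
  have := Fintype.ofFinite ι
  choose k hk using fun i => IsPGroup.iff_card.1 (hP i)
  refine IsPGroup.of_card (n := ∑ i, k i) ?_
  rw [Nat.card_pi, Finset.prod_congr rfl fun i _ => hk i, Finset.prod_pow_eq_pow_sum]

theorem PowIndexSubgroup.finite_pQuotient {G : Type*} [Group G] (N : PowIndexSubgroup p G) :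
    Finite (PQuotient N) := by
  obtain ⟨k, hk⟩ := N.index_eq
  have hfin : N.toSubgroup.FiniteIndex := ⟨by
    rw [hk]; exact pow_ne_zero _ (Fact.out : p.Prime).ne_zero⟩
  exact inferInstanceAs (Finite (G ⧸ N.toSubgroup))

/-- The projection of `G` to one of its `p`-quotients. -/
def PQuotient.mk {p : ℕ} {G : Type*} [Group G] (N : PowIndexSubgroup p G) : G →* PQuotient N :=
  QuotientGroup.mk' N.toSubgroup

/-- The canonical map of a group to its pro-`p` completion. -/
def toProP (p : ℕ) (G : Type*) [Group G] : G →* proPCompletion p G where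
  toFun g := ⟨fun N => PQuotient.mk N g, fun _ _ _ => rfl⟩
  map_one' := Subtype.ext (funext fun N => map_one (PQuotient.mk N))
  map_mul' a b := Subtype.ext (funext fun N => map_mul (PQuotient.mk N) a b)

theorem dense_closure_toProP {G : Type*} [Group G] {ι : Type*} (s : ι → G)
    (hs : ∀ χ : G →* Multiplicative (ZMod p), (∀ i, χ (s i) = 1) → χ = 1) :
    Dense (Subgroup.closure (Set.range fun i => toProP p G (s i)) :
      Set (proPCompletion p G)) := by
  intro x
  rw [mem_closure_iff]
  intro o ho hx
  obtain ⟨U, hU, rfl⟩ := isOpen_induced_iff.1 ho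
  obtain ⟨I, u, hu, hIu⟩ := isOpen_pi_iff.1 hU x.1 hx
  have := fun N : PowIndexSubgroup p G => N.finite_pQuotient
  let φ : G →* ∀ N : I, PQuotient N.1 := MonoidHom.pi fun N => PQuotient.mk N.1
  -- A basic open set constrains finitely many coordinates `N ∈ I`. The intersection `M` of these
  -- subgroups again has `p`-power index, so it is enough to match `x` in the single quotient by
  -- `M`.
  let M : PowIndexSubgroup p G :=
    PowIndexSubgroup.ofKer (isPGroup_pi fun N : I => N.1.isPGroup_pQuotient) φ
  obtain ⟨g, hg⟩ := QuotientGroup.mk'_surjective M.toSubgroup (x.1 M)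
  obtain ⟨c, hc, n, hn, rfl⟩ := Subgroup.mem_sup_of_normal_right.1
    (closure_sup_eq_top s hs M ▸ Subgroup.mem_top g)
  refine ⟨toProP p G c, hIu fun N hN => ?_, ?_⟩
  · have hle : M.toSubgroup ≤ N.toSubgroup := fun y hy =>
      (QuotientGroup.eq_one_iff y).1 (congrFun (MonoidHom.mem_ker.1 hy) ⟨N, hN⟩)
    have e : x.1 N = PQuotient.mk N (c * n) := by
      rw [← x.2 M N hle, ← hg]
      rfl
    have e' : PQuotient.mk N (c * n) = PQuotient.mk N c := by
      have hn1 : PQuotient.mk N n = 1 := (QuotientGroup.eq_one_iff n).2 (hle hn)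
      rw [map_mul, hn1, mul_one]
    change PQuotient.mk N c ∈ u N
    rw [← e', ← e]
    exact (hu N hN).2
  · have : Subgroup.closure (Set.range s) ≤
        (Subgroup.closure (Set.range fun i => toProP p G (s i))).comap (toProP p G) :=
      (Subgroup.closure_le _).2 (by
        rintro _ ⟨i, rfl⟩
        exact Subgroup.subset_closure ⟨i, rfl⟩)
    exact this hc

/-- If the group has finitely many characters to `ℤ/p`, then topological generators of the pro-`p`
completion can be approximated by elements of the group that no nontrivial character kills. -/
theorem exists_family_of_dense_closure {G : Type*} [Group G]
    [Finite (G →* Multiplicative (ZMod p))] {ι : Type*} (s : ι → proPCompletion p G)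
    (hs : Dense (Subgroup.closure (Set.range s) : Set (proPCompletion p G))) :
    ∃ g : ι → G, ∀ χ : G →* Multiplicative (ZMod p), (∀ i, χ (g i) = 1) → χ = 1 := by
  have hZ : IsPGroup p (Multiplicative (ZMod p)) :=
    IsPGroup.of_card (n := 1) (by rw [pow_one]; exact Nat.card_zmod p)
  have : Finite (Multiplicative (ZMod p)) := inferInstanceAs (Finite (ZMod p))
  let φ : G →* ((G →* Multiplicative (ZMod p)) → Multiplicative (ZMod p)) :=
    MonoidHom.pi fun χ => χ
  -- `N` is the common kernel of all characters. Its index is a power of `p` because there are only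
  -- finitely many of them, and each character factors through the coordinate at `N`.
  let N : PowIndexSubgroup p G := PowIndexSubgroup.ofKer (isPGroup_pi fun _ => hZ) φ
  choose g hg using fun i => QuotientGroup.mk'_surjective N.toSubgroup ((s i).1 N)
  refine ⟨g, fun χ hχ => MonoidHom.ext fun x => ?_⟩
  have hle : N.toSubgroup ≤ χ.ker := fun y hy => congrFun (MonoidHom.mem_ker.1 hy) χ
  let ev : proPCompletion p G →* Multiplicative (ZMod p) :=
    (QuotientGroup.lift N.toSubgroup χ hle).comp
      ((Pi.evalMonoidHom (fun M : PowIndexSubgroup p G => PQuotient M) N).comp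
        (proPCompletion p G).subtype)
  have hev : Subgroup.closure (Set.range s) ≤ ev.ker := by
    rw [Subgroup.closure_le]
    rintro _ ⟨i, rfl⟩
    change QuotientGroup.lift N.toSubgroup χ hle ((s i).1 N) = 1
    rw [← hg i]
    exact hχ i
  have := pQuotient_discrete N
  obtain ⟨y, hy, hyc⟩ := hs.inter_open_nonempty
    {y : proPCompletion p G | y.1 N = PQuotient.mk N x}
    ((isOpen_discrete {PQuotient.mk N x}).preimage
      ((continuous_apply N).comp continuous_subtype_val)) ⟨toProP p G x, rfl⟩
  have h1 : ev y = 1 := hev hyc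
  have h2 : ev y = χ x := by
    change QuotientGroup.lift N.toSubgroup χ hle (y.1 N) = χ x
    rw [show y.1 N = PQuotient.mk N x from hy]
    rfl
  rw [← h2, h1, MonoidHom.one_apply]

instance finite_presentedGroup_character {d : ℕ} (S : Set (FreeGroup (Fin d))) :
    Finite (PresentedGroup S →* Multiplicative (ZMod p)) := by
  have : Finite (Multiplicative (ZMod p)) := inferInstanceAs (Finite (ZMod p))
  exact Finite.of_injective
    (fun (χ : PresentedGroup S →* Multiplicative (ZMod p)) (i : Fin d) => χ (PresentedGroup.of i))
    fun χ ψ h => PresentedGroup.ext fun i => congrFun h i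

/-- Characters to `ℤ/p` detect topological generation of the pro-`p` completion. Pulled back to the
free group, the criterion involves `S` only through the characters that kill it, so different
relator sets can be compared. -/
theorem topRank_proPCompletion_presentedGroup {d : ℕ} (S : Set (FreeGroup (Fin d))) :
    topRank (proPCompletion p (PresentedGroup S)) =
      sInf {n : ℕ | ∃ f : Fin n → FreeGroup (Fin d),
        ∀ χ : FreeGroup (Fin d) →* Multiplicative (ZMod p), (∀ r ∈ S, χ r = 1) →
          (∀ i, χ (f i) = 1) → χ = 1} := by
  rw [topRank]
  congr 1
  ext n
  constructor
  · rintro ⟨s, hs⟩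
    obtain ⟨g, hg⟩ := exists_family_of_dense_closure s hs
    choose f hf using fun i => PresentedGroup.mk_surjective S (g i)
    refine ⟨f, fun χ hχ hf1 => ?_⟩
    have hlift : FreeGroup.lift (fun i => χ (FreeGroup.of i)) = χ :=
      FreeGroup.lift.apply_symm_apply χ
    have hrel : ∀ r ∈ S, FreeGroup.lift (fun i => χ (FreeGroup.of i)) r = 1 := by rwa [hlift]
    have hmk : ∀ x, PresentedGroup.toGroup hrel (PresentedGroup.mk S x) = χ x :=
      DFunLike.congr_fun hlift
    have h1 := hg _ fun i => by rw [← hf i, hmk, hf1 i]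
    ext x
    rw [← hmk, h1]
    rfl
  · rintro ⟨f, hf⟩
    refine ⟨_, dense_closure_toProP (fun i => PresentedGroup.mk S (f i)) fun χ hχ => ?_⟩
    have h1 := hf (χ.comp (PresentedGroup.mk S)) (fun r hr => by
      rw [MonoidHom.comp_apply, PresentedGroup.one_of_mem hr, map_one]) hχ
    exact PresentedGroup.ext fun i => DFunLike.congr_fun h1 (FreeGroup.of i)

theorem topRank_proPCompletion_presentedGroup_le {d : ℕ} (S : Set (FreeGroup (Fin d))) :
    topRank (proPCompletion p (PresentedGroup S)) ≤ d := by
  rw [topRank_proPCompletion_presentedGroup]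
  exact Nat.sInf_le ⟨FreeGroup.of, fun χ _ h => FreeGroup.ext_hom _ _ h⟩

/-- Every character to `ℤ/p` is trivial on the second term of the Zassenhaus filtration. -/
theorem character_eq_one_of_mem_zassenhaus_two {d : ℕ}
    (χ : FreeGroup (Fin d) →* Multiplicative (ZMod p)) {f : FreeGroup (Fin d)}
    (hf : f ∈ zassenhaus p d 2) : χ f = 1 := by
  -- Magnus series have constant term 1, so their linear coefficients are additive in the group
  -- element. Hence every character is a linear combination of these coefficients.
  let ψ : FreeGroup (Fin d) →* Multiplicative (ZMod p) :=
    { toFun := fun g => Multiplicative.ofAdd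
        (∑ i, Multiplicative.toAdd (χ (FreeGroup.of i)) * magnusSeries p g [i])
      map_one' := by simp [magnusSeries_one, NCSeries.one_apply]
      map_mul' := fun a b => by
        rw [← ofAdd_add, ← Finset.sum_add_distrib]
        congr 1
        refine Finset.sum_congr rfl fun i _ => ?_
        rw [magnusSeries_mul, NCSeries.mul_apply]
        simp [Finset.sum_range_succ, magnusSeries_nil]
        ring }
  have hχ : χ = ψ := by
    refine FreeGroup.ext_hom _ _ fun i => ?_
    change χ (FreeGroup.of i) = Multiplicative.ofAdd
      (∑ j, Multiplicative.toAdd (χ (FreeGroup.of j)) * magnusSeries p (FreeGroup.of i) [j])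
    have h : ∀ j, magnusSeries p (FreeGroup.of i) [j] = if j = i then 1 else 0 := fun j => by
      simp [magnusSeries_of, NCSeries.add_apply, NCSeries.one_apply, X]
    simp [h]
  rw [hχ]
  change Multiplicative.ofAdd
      (∑ j, Multiplicative.toAdd (χ (FreeGroup.of j)) * magnusSeries p f [j]) = 1
  rw [Finset.sum_eq_zero, ofAdd_zero]
  intro j _
  have : magnusSeries p f [j] - (1 : NCSeries (ZMod p) d) [j] = 0 := hf [j] (by simp)
  rw [NCSeries.one_apply, if_neg (by simp), sub_zero] at this
  rw [this, mul_zero]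

theorem topRank_union_eq {d : ℕ} (S E : Set (FreeGroup (Fin d))) (hE : E ⊆ zassenhaus p d 2) :
    topRank (proPCompletion p (PresentedGroup (S ∪ E))) =
      topRank (proPCompletion p (PresentedGroup S)) := by
  rw [topRank_proPCompletion_presentedGroup, topRank_proPCompletion_presentedGroup]
  congr 1
  ext n
  refine exists_congr fun f => forall_congr' fun χ => ?_
  have : (∀ r ∈ S ∪ E, χ r = 1) ↔ ∀ r ∈ S, χ r = 1 :=
    ⟨fun h r hr => h r (Or.inl hr), fun h r hr => hr.elim (h r) fun hr =>
      character_eq_one_of_mem_zassenhaus_two χ (hE hr)⟩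
  rw [this]

end TopRank


/-! ### Computability of the word problem of a free group and of the Zassenhaus filtration -/

section Computability

/-- The words in the letters `x_i` and `x_i⁻¹`. -/
abbrev LetterWord (d : ℕ) : Type := List (Fin d × Bool)

/-- Free reduction is a right fold: each new letter either cancels against the head of the reduced
tail or is prepended. -/
theorem primrec_reduce (d : ℕ) :
    Primrec (FreeGroup.reduce : LetterWord d → LetterWord d) := by
  let step : (Fin d × Bool) × LetterWord d → LetterWord d := fun x =>
    List.casesOn x.2 [x.1] fun hd tl =>
      if x.1.1 = hd.1 ∧ x.1.2 = !hd.2 then tl else x.1 :: hd :: tl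
  have hstep : Primrec step := by
    refine Primrec.list_casesOn (h := fun (x : (Fin d × Bool) × LetterWord d)
      (y : (Fin d × Bool) × LetterWord d) =>
        if x.1.1 = y.1.1 ∧ x.1.2 = !y.1.2 then y.2 else x.1 :: y.1 :: y.2) Primrec.snd
      (Primrec.list_cons.comp Primrec.fst (Primrec.const [])) ?_
    have hx : Primrec fun z : ((Fin d × Bool) × LetterWord d) × ((Fin d × Bool) × LetterWord d) =>
      z.1.1 := Primrec.fst.comp Primrec.fst
    have hy : Primrec fun z : ((Fin d × Bool) × LetterWord d) × ((Fin d × Bool) × LetterWord d) =>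
      z.2.1 := Primrec.fst.comp Primrec.snd
    exact Primrec.ite
      ((Primrec.eq.comp (Primrec.fst.comp hx) (Primrec.fst.comp hy)).and
        (Primrec.eq.comp (Primrec.snd.comp hx) (Primrec.not.comp (Primrec.snd.comp hy))))
      (Primrec.snd.comp Primrec.snd)
      (Primrec.list_cons.comp hx (Primrec.list_cons.comp hy (Primrec.snd.comp Primrec.snd)))
  have h := Primrec.list_foldr (f := fun L : LetterWord d => L) (g := fun _ => [])
    (h := fun _ x => step x) Primrec.id (Primrec.const []) (hstep.comp Primrec.snd)
  refine h.of_eq fun L => ?_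
  induction L with
  | nil => rfl
  | cons x L ih =>
    rw [List.foldr_cons, ih, FreeGroup.reduce.cons]

theorem primrecRel_mk_eq (d : ℕ) :
    PrimrecRel fun L M : LetterWord d => FreeGroup.mk L = FreeGroup.mk M := by
  refine (Primrec.eq.comp ((primrec_reduce d).comp Primrec.fst)
    ((primrec_reduce d).comp Primrec.snd)).of_eq fun x => ⟨FreeGroup.reduce.exact, fun h => ?_⟩
  rw [← FreeGroup.toWord_mk, h, FreeGroup.toWord_mk]

/-- The words of length less than `n`. -/
def shortWords (d n : ℕ) : List (List (Fin d)) :=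
  (fun W => [] :: W.flatMap fun w => (List.finRange d).map fun a => a :: w)^[n] []

theorem mem_shortWords {d n : ℕ} {w : List (Fin d)} : w ∈ shortWords d n ↔ w.length < n := by
  induction n generalizing w with
  | zero => simp [shortWords]
  | succ n ih =>
    rw [shortWords, Function.iterate_succ_apply', ← shortWords]
    cases w with
    | nil => simp
    | cons a w => simp [ih]

theorem primrec_shortWords (d : ℕ) : Primrec (shortWords d) := by
  refine Primrec.nat_iterate (h := fun (_ : ℕ) (W : List (List (Fin d))) =>
    [] :: W.flatMap fun w => (List.finRange d).map fun a => a :: w) Primrec.id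
    (Primrec.const []) (Primrec.list_cons.comp (Primrec.const []) ?_)
  refine Primrec.list_flatMap Primrec.snd (Primrec.list_map (Primrec.const _) ?_)
  exact Primrec.list_cons.comp Primrec.snd (Primrec.snd.comp Primrec.fst)

/-- One step of the computation of the coefficients of `π(x g)` at the suffixes of a word from
those of `π(g)`, where `x` is a letter. The accumulator consists of the new coefficients, and of
the old and the new coefficient at the current suffix. -/
def coefStep (p : ℕ) {d : ℕ} (l : Fin d × Bool) (x : Fin d × ℕ)
    (acc : List (Fin d × ℕ) × ℕ × ℕ) : List (Fin d × ℕ) × ℕ × ℕ :=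
  let c := (x.2 + if x.1 = l.1 then (if l.2 = true then acc.2.1 else (p - 1) * acc.2.2) else 0) % p
  ((x.1, c) :: acc.1, x.2, c)

/-- The coefficients of the Magnus series of a word at the suffixes of `w`. -/
def suffixCoefs (p : ℕ) {d : ℕ} (L : LetterWord d) (w : List (Fin d)) : List (Fin d × ℕ) :=
  L.foldr (fun l s => (s.foldr (coefStep p l) ([], 1, 1)).1) (w.map fun a => (a, 0))

theorem primrec_suffixCoefs (p d : ℕ) :
    Primrec₂ (suffixCoefs p : LetterWord d → List (Fin d) → List (Fin d × ℕ)) := by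
  have hstep : Primrec fun z : (Fin d × Bool) × (Fin d × ℕ) × List (Fin d × ℕ) × ℕ × ℕ =>
      coefStep p z.1 z.2.1 z.2.2 := by
    have hx : Primrec fun z : (Fin d × Bool) × (Fin d × ℕ) × List (Fin d × ℕ) × ℕ × ℕ => z.2.1 :=
      Primrec.fst.comp Primrec.snd
    have hacc : Primrec fun z : (Fin d × Bool) × (Fin d × ℕ) × List (Fin d × ℕ) × ℕ × ℕ =>
      z.2.2 := Primrec.snd.comp Primrec.snd
    have hc : Primrec fun z : (Fin d × Bool) × (Fin d × ℕ) × List (Fin d × ℕ) × ℕ × ℕ =>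
        (z.2.1.2 + if z.2.1.1 = z.1.1 then
          (if z.1.2 = true then z.2.2.2.1 else (p - 1) * z.2.2.2.2) else 0) % p := by
      refine Primrec.nat_mod.comp (Primrec.nat_add.comp (Primrec.snd.comp hx) ?_)
        (Primrec.const p)
      refine Primrec.ite
        (Primrec.eq.comp (Primrec.fst.comp hx) (Primrec.fst.comp Primrec.fst)) ?_
        (Primrec.const 0)
      refine Primrec.ite (Primrec.eq.comp (Primrec.snd.comp Primrec.fst) (Primrec.const true))
        (Primrec.fst.comp (Primrec.snd.comp hacc)) ?_
      exact Primrec.nat_mul.comp (Primrec.const _) (Primrec.snd.comp (Primrec.snd.comp hacc))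
    exact Primrec.pair
      (Primrec.list_cons.comp (Primrec.pair (Primrec.fst.comp hx) hc) (Primrec.fst.comp hacc))
      (Primrec.pair (Primrec.snd.comp hx) hc)
  refine Primrec.list_foldr (h := fun _ (y : (Fin d × Bool) × List (Fin d × ℕ)) =>
    (y.2.foldr (coefStep p y.1) ([], 1, 1)).1) Primrec.fst
    (Primrec.list_map Primrec.snd (Primrec.pair Primrec.snd (Primrec.const 0))) ?_
  refine Primrec.fst.comp (Primrec.list_foldr
    (h := fun (z : (LetterWord d × List (Fin d)) × (Fin d × Bool) × List (Fin d × ℕ))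
      (y : (Fin d × ℕ) × List (Fin d × ℕ) × ℕ × ℕ) => coefStep p z.2.1 y.1 y.2)
    (Primrec.snd.comp Primrec.snd) (Primrec.const _) ?_)
  exact hstep.comp (Primrec.pair (Primrec.fst.comp (Primrec.snd.comp Primrec.fst)) Primrec.snd)

variable {p d : ℕ}

/-- The coefficients of a series at the nonempty suffixes of a word, as natural numbers less than
`p`. -/
def suffixVals (f : NCSeries (ZMod p) d) : List (Fin d) → List (Fin d × ℕ)
  | [] => []
  | a :: w => (a, (f (a :: w)).val) :: suffixVals f w

theorem suffixVals_congr {f g : NCSeries (ZMod p) d} (w : List (Fin d))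
    (h : ∀ v : List (Fin d), v.length ≤ w.length → f v = g v) :
    suffixVals f w = suffixVals g w := by
  induction w with
  | nil => rfl
  | cons a w ih =>
    rw [suffixVals, suffixVals, ih fun v hv => h v (by simp; omega), h _ le_rfl]

variable [Fact p.Prime]

theorem magnusSeries_letter_true (a i : Fin d) (f : FreeGroup (Fin d)) (w : List (Fin d)) :
    magnusSeries p (FreeGroup.mk [(i, true)] * f) (a :: w) =
      magnusSeries p f (a :: w) + if a = i then magnusSeries p f w else 0 := by
  have e : (FreeGroup.mk [(i, true)] : FreeGroup (Fin d)) = FreeGroup.of i := rfl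
  rw [e, magnusSeries_mul, magnusSeries_of, add_mul, one_mul, NCSeries.add_apply, X_mul_cons]

/-- Obtained by solving the rule for `x_i`, applied to `x_i⁻¹ * f`. The correction involves the new
series at the shorter word, which is why `coefStep` carries the new coefficient along with the old.
-/
theorem magnusSeries_letter_false (a i : Fin d) (f : FreeGroup (Fin d)) (w : List (Fin d)) :
    magnusSeries p (FreeGroup.mk [(i, false)] * f) (a :: w) = magnusSeries p f (a :: w) -
      if a = i then magnusSeries p (FreeGroup.mk [(i, false)] * f) w else 0 := by
  have h := magnusSeries_letter_true (p := p) a i (FreeGroup.mk [(i, false)] * f) w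
  have e : (FreeGroup.mk [(i, true)] * (FreeGroup.mk [(i, false)] * f) : FreeGroup (Fin d)) = f := by
    rw [← mul_assoc, FreeGroup.mul_mk]
    have : (FreeGroup.mk ([(i, true)] ++ [(i, false)]) : FreeGroup (Fin d)) = 1 :=
      mul_inv_cancel (FreeGroup.of i)
    rw [this, one_mul]
  rw [e] at h
  rw [h, add_sub_cancel_right]

/-- Correctness of the inner loop. The initial values 1 are the constant terms of the two series,
and the factor `p - 1` in `coefStep` stands for `-1`. -/
theorem foldr_coefStep (l : Fin d × Bool) (f : FreeGroup (Fin d)) (w : List (Fin d)) :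
    (suffixVals (magnusSeries p f) w).foldr (coefStep p l) ([], 1, 1) =
      (suffixVals (magnusSeries p (FreeGroup.mk [l] * f)) w, (magnusSeries p f w).val,
        (magnusSeries p (FreeGroup.mk [l] * f) w).val) := by
  have hp : 1 < p := (Fact.out : p.Prime).one_lt
  induction w with
  | nil =>
    have := Fact.mk hp
    simp [suffixVals, magnusSeries_nil, ZMod.val_one]
  | cons a w ih =>
    have key : ((magnusSeries p f (a :: w)).val + if a = l.1 then (if l.2 = true then
        (magnusSeries p f w).val else (p - 1) * (magnusSeries p (FreeGroup.mk [l] * f) w).val)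
          else 0) % p = (magnusSeries p (FreeGroup.mk [l] * f) (a :: w)).val := by
      rw [← ZMod.val_natCast]
      congr 1
      obtain ⟨i, b⟩ := l
      rcases b with _ | _
      · rw [magnusSeries_letter_false]
        split_ifs <;> simp_all [Nat.cast_sub hp.le, sub_eq_add_neg]
      · rw [magnusSeries_letter_true]
        split_ifs <;> simp_all
    rw [suffixVals, List.foldr_cons, ih, coefStep]
    simp only [key]
    rfl

theorem suffixCoefs_eq (L : LetterWord d) (w : List (Fin d)) :
    suffixCoefs p L w = suffixVals (magnusSeries p (FreeGroup.mk L)) w := by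
  induction L with
  | nil =>
    have h1 : (FreeGroup.mk [] : FreeGroup (Fin d)) = 1 := rfl
    rw [h1, magnusSeries_one]
    induction w with
    | nil => rfl
    | cons a w ih =>
      rw [suffixVals, ← ih, NCSeries.one_apply]
      simp [suffixCoefs]
  | cons l L ih =>
    rw [suffixCoefs, List.foldr_cons, ← suffixCoefs, ih, foldr_coefStep, FreeGroup.mul_mk]
    rfl

/-- Two elements of the free group have the same image modulo `I ^ n`. -/
def SameLowCoefs (p : ℕ) {d : ℕ} (n : ℕ) (f g : FreeGroup (Fin d)) : Prop :=
  ∀ w : List (Fin d), w.length < n → magnusSeries p f w = magnusSeries p g w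

theorem sameLowCoefs_iff (n : ℕ) (L M : LetterWord d) :
    SameLowCoefs p n (FreeGroup.mk L) (FreeGroup.mk M) ↔
      ∀ w ∈ shortWords d n, suffixCoefs p L w = suffixCoefs p M w := by
  constructor
  · intro h w hw
    rw [suffixCoefs_eq, suffixCoefs_eq]
    exact suffixVals_congr w fun v hv => h v (hv.trans_lt (mem_shortWords.1 hw))
  · intro h w hw
    have := h w (mem_shortWords.2 hw)
    rw [suffixCoefs_eq, suffixCoefs_eq] at this
    cases w with
    | nil => rw [magnusSeries_nil, magnusSeries_nil]
    | cons a w =>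
      rw [suffixVals, suffixVals] at this
      exact ZMod.val_injective p (Prod.ext_iff.1 (List.cons_eq_cons.1 this).1).2

theorem primrecRel_sameLowCoefs :
    PrimrecRel fun (n : ℕ) (x : LetterWord d × LetterWord d) =>
      SameLowCoefs p n (FreeGroup.mk x.1) (FreeGroup.mk x.2) := by
  have h : PrimrecRel fun (w : List (Fin d)) (x : LetterWord d × LetterWord d) =>
      suffixCoefs p x.1 w = suffixCoefs p x.2 w :=
    Primrec.eq.comp
      ((primrec_suffixCoefs p d).comp (Primrec.fst.comp Primrec.snd) Primrec.fst)
      ((primrec_suffixCoefs p d).comp (Primrec.snd.comp Primrec.snd) Primrec.fst)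
  exact (h.forall_mem_list.comp ((primrec_shortWords d).comp Primrec.fst) Primrec.snd).of_eq
    fun x => (sameLowCoefs_iff _ _ _).symm

theorem SameLowCoefs.inv_mul_mem_zassenhaus {n : ℕ} {f g : FreeGroup (Fin d)}
    (h : SameLowCoefs p n f g) : f⁻¹ * g ∈ zassenhaus p d n := by
  rw [mem_zassenhaus]
  have e : magnusSeries p (f⁻¹ * g) - 1 =
      magnusSeries p f⁻¹ * (magnusSeries p g - magnusSeries p f) := by
    rw [mul_sub, ← magnusSeries_mul, magnusSeries_inv_mul]
  rw [e]
  exact mul_mem_lowOrder_left _ fun w hw => sub_eq_zero.2 (h w hw).symm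

/-- Pigeonhole: over `ZMod p` there are only finitely many truncations. -/
theorem exists_sameLowCoefs_of_infinite {W : Set (FreeGroup (Fin d))} (hW : W.Infinite) (n : ℕ) :
    ∃ f ∈ W, ∃ g ∈ W, f ≠ g ∧ SameLowCoefs p n f g := by
  obtain ⟨f, hf, g, hg, hne, h⟩ := hW.exists_ne_map_eq_of_mapsTo
    (f := fun f => trunc (ZMod p) d n (magnusSeries p f)) (t := Set.univ) (fun _ _ => trivial)
    Set.finite_univ
  exact ⟨f, hf, g, hg, hne, fun w hw => congrFun h ⟨w, hw⟩⟩

end Computability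


/-! ### The collision relators -/

section Collisions

/-- Unbounded search for the witness halts exactly when there is one. -/
theorem rePred_exists_nat {α : Type*} [Primcodable α] {R : α → ℕ → Prop} (hR : PrimrecRel R) :
    REPred fun a => ∃ n, R a n := by
  classical
  have h : Partrec₂ fun (a : α) (n : ℕ) => (Part.some (decide (R a n)) : Part Bool) :=
    (PrimrecPred.decide hR).to_comp
  refine (Partrec.rfind h).dom_re.of_eq fun a => ?_
  refine Nat.rfind_dom.trans ?_
  simp

theorem REPred.or' {α : Type*} [Primcodable α] {P Q : α → Prop} (hP : REPred P) (hQ : REPred Q) :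
    REPred fun a => P a ∨ Q a := by
  obtain ⟨k, hk, h⟩ := Partrec.merge' hP hQ
  exact hk.dom_re.of_eq fun a => by rw [(h a).2]; simp [Part.assert]

theorem IsCE.union {d : ℕ} {S T : Set (FreeGroup (Fin d))} (hS : IsCE S) (hT : IsCE T) :
    IsCE (S ∪ T) := REPred.or' hS hT

variable {d : ℕ}

/-- The `e`-th program halts on the word `L` within `m` steps. -/
def HaltsWithin (e m : ℕ) (L : LetterWord d) : Prop :=
  (Nat.Partrec.Code.evaln m (Denumerable.ofNat Nat.Partrec.Code e) (Encodable.encode L)).isSome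

theorem primrecPred_haltsWithin :
    PrimrecPred fun x : (ℕ × ℕ) × LetterWord d => HaltsWithin x.1.1 x.1.2 x.2 := by
  refine Primrec.eq.comp (Primrec.option_isSome.comp (Nat.Partrec.Code.primrec_evaln.comp
    (Primrec.pair (Primrec.pair (Primrec.snd.comp Primrec.fst)
      ((Primrec.ofNat _).comp (Primrec.fst.comp Primrec.fst)))
      (Primrec.encode.comp Primrec.snd)))) (Primrec.const true)

theorem HaltsWithin.mono {e m n : ℕ} {L : LetterWord d} (h : HaltsWithin e m L) (hmn : m ≤ n) :
    HaltsWithin e n L := by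
  obtain ⟨x, hx⟩ := Option.isSome_iff_exists.1 h
  exact Option.isSome_iff_exists.2 ⟨x, Nat.Partrec.Code.evaln_mono hmn hx⟩

/-- Every computably enumerable set is enumerated by some program. -/
theorem IsCE.exists_program {W : Set (FreeGroup (Fin d))} (hW : IsCE W) :
    ∃ e, ∀ L : LetterWord d, FreeGroup.mk L ∈ W ↔ ∃ m, HaltsWithin e m L := by
  obtain ⟨c, hc⟩ := Nat.Partrec.Code.exists_code.1 hW
  refine ⟨Encodable.encode c, fun L => ?_⟩
  have h1 : FreeGroup.mk L ∈ W ↔ (c.eval (Encodable.encode L)).Dom := by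
    rw [hc]
    simp [Part.assert]
  rw [h1, Part.dom_iff_mem]
  simp only [Nat.Partrec.Code.evaln_complete, HaltsWithin, Option.isSome_iff_exists,
    Denumerable.ofNat_encode]
  exact exists_comm

/-- The triple with code `k`: a number of steps and two words. -/
def decodeTriple (d k : ℕ) : ℕ × LetterWord d × LetterWord d :=
  (Encodable.decode k).getD (0, [], [])

theorem primrec_decodeTriple : Primrec (decodeTriple d) :=
  Primrec.option_getD.comp Primrec.decode (Primrec.const _)

theorem decodeTriple_encode (x : ℕ × LetterWord d × LetterWord d) :
    decodeTriple d (Encodable.encode x) = x := by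
  simp [decodeTriple]

/-- `k` codes two distinct elements of the `e`-th computably enumerable set that have the same
image modulo `I ^ (N + e)`. -/
def IsCollision (p d N e k : ℕ) : Prop :=
  HaltsWithin e (decodeTriple d k).1 (decodeTriple d k).2.1 ∧
  HaltsWithin e (decodeTriple d k).1 (decodeTriple d k).2.2 ∧
  FreeGroup.mk (decodeTriple d k).2.1 ≠ FreeGroup.mk (decodeTriple d k).2.2 ∧
  SameLowCoefs p (N + e) (FreeGroup.mk (decodeTriple d k).2.1)
    (FreeGroup.mk (decodeTriple d k).2.2)

/-- `k` is the least code of a collision in the `e`-th computably enumerable set. -/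
def IsFirstCollision (p d N e k : ℕ) : Prop :=
  IsCollision p d N e k ∧ ∀ j < k, ¬ IsCollision p d N e j

/-- The relator that identifies the two elements coded by `k`. -/
def collisionRelator (d k : ℕ) : FreeGroup (Fin d) :=
  (FreeGroup.mk (decodeTriple d k).2.1)⁻¹ * FreeGroup.mk (decodeTriple d k).2.2

/-- The relators of the first collisions in all computably enumerable sets. -/
def collisionRelators (p d N : ℕ) : Set (FreeGroup (Fin d)) :=
  {r | ∃ e k, IsFirstCollision p d N e k ∧ r = collisionRelator d k}

theorem IsFirstCollision.unique {p d N e k j : ℕ} (hk : IsFirstCollision p d N e k)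
    (hj : IsFirstCollision p d N e j) : k = j := by
  rcases lt_trichotomy k j with h | h | h
  · exact absurd hk.1 (hj.2 k h)
  · exact h
  · exact absurd hj.1 (hk.2 j h)

theorem IsCollision.exists_first {p d N e k : ℕ} (h : IsCollision p d N e k) :
    ∃ j, IsFirstCollision p d N e j := by
  classical
  exact ⟨Nat.find ⟨k, h⟩, Nat.find_spec ⟨k, h⟩, fun _ hj => Nat.find_min ⟨k, h⟩ hj⟩

variable {p : ℕ} [Fact p.Prime]

theorem primrecRel_isCollision (N : ℕ) : PrimrecRel fun k e => IsCollision p d N e k := by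
  have ht : Primrec fun x : ℕ × ℕ => decodeTriple d x.1 := primrec_decodeTriple.comp Primrec.fst
  have h1 : Primrec fun x : ℕ × ℕ => (decodeTriple d x.1).2.1 :=
    Primrec.fst.comp (Primrec.snd.comp ht)
  have h2 : Primrec fun x : ℕ × ℕ => (decodeTriple d x.1).2.2 :=
    Primrec.snd.comp (Primrec.snd.comp ht)
  have hem : Primrec fun x : ℕ × ℕ => (x.2, (decodeTriple d x.1).1) :=
    Primrec.pair Primrec.snd (Primrec.fst.comp ht)
  exact (primrecPred_haltsWithin.comp (Primrec.pair hem h1)).and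
    ((primrecPred_haltsWithin.comp (Primrec.pair hem h2)).and
      (((primrecRel_mk_eq d).comp h1 h2).not.and
        (primrecRel_sameLowCoefs.comp
          (Primrec.nat_add.comp (Primrec.const N) Primrec.snd) (Primrec.pair h1 h2))))

theorem primrecRel_isFirstCollision (N : ℕ) :
    PrimrecRel fun k e => IsFirstCollision p d N e k := by
  have h : PrimrecRel fun k e => ¬ IsCollision p d N e k := (primrecRel_isCollision N).not
  exact PrimrecPred.and (primrecRel_isCollision N) h.forall_lt

/-- Substitution of words for the letters of a word. -/
def substWord {d' : ℕ} (φ : FreeGroup (Fin d) →* FreeGroup (Fin d')) (L : LetterWord d) :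
    LetterWord d' := L.flatMap fun l => (φ (FreeGroup.mk [l])).toWord

theorem mk_substWord {d' : ℕ} (φ : FreeGroup (Fin d) →* FreeGroup (Fin d')) (L : LetterWord d) :
    FreeGroup.mk (substWord φ L) = φ (FreeGroup.mk L) := by
  induction L with
  | nil => exact (map_one φ).symm
  | cons l L ih =>
    rw [substWord, List.flatMap_cons, ← FreeGroup.mul_mk, ← substWord, ih, FreeGroup.mk_toWord,
      ← map_mul, FreeGroup.mul_mk]
    rfl

theorem primrec_substWord {d' : ℕ} (φ : FreeGroup (Fin d) →* FreeGroup (Fin d')) :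
    Primrec (substWord φ) :=
  Primrec.list_flatMap Primrec.id
    ((Primrec.dom_finite fun l : Fin d × Bool => (φ (FreeGroup.mk [l])).toWord).comp Primrec.snd)

/-- A word `L` is accepted when a search over pairs `(k, e)` finds a first collision `u`, `v` with
`φ u * L = φ v`. The homomorphism `φ` lets the relators be rewritten in another generating set. -/
theorem isCE_image_collisionRelators {d' : ℕ} (φ : FreeGroup (Fin d) →* FreeGroup (Fin d'))
    (N : ℕ) : IsCE (φ '' collisionRelators p d N) := by
  have hk : Primrec fun x : LetterWord d' × ℕ => x.2.unpair.1 :=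
    Primrec.fst.comp (Primrec.unpair.comp Primrec.snd)
  have he : Primrec fun x : LetterWord d' × ℕ => x.2.unpair.2 :=
    Primrec.snd.comp (Primrec.unpair.comp Primrec.snd)
  have ht : Primrec fun x : LetterWord d' × ℕ => (decodeTriple d x.2.unpair.1).2 :=
    Primrec.snd.comp (primrec_decodeTriple.comp hk)
  have hR : PrimrecRel fun (L : LetterWord d') (n : ℕ) =>
      IsFirstCollision p d N n.unpair.2 n.unpair.1 ∧
        FreeGroup.mk (substWord φ (decodeTriple d n.unpair.1).2.1 ++ L) =
          FreeGroup.mk (substWord φ (decodeTriple d n.unpair.1).2.2) :=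
    PrimrecPred.and ((primrecRel_isFirstCollision N).comp hk he)
      ((primrecRel_mk_eq d').comp
        (Primrec.list_append.comp ((primrec_substWord φ).comp (Primrec.fst.comp ht)) Primrec.fst)
        ((primrec_substWord φ).comp (Primrec.snd.comp ht)))
  refine (rePred_exists_nat hR).of_eq fun L => ?_
  have key : ∀ k, FreeGroup.mk (substWord φ (decodeTriple d k).2.1 ++ L) =
      FreeGroup.mk (substWord φ (decodeTriple d k).2.2) ↔
        φ (collisionRelator d k) = FreeGroup.mk L := by
    intro k
    rw [← FreeGroup.mul_mk, mk_substWord, mk_substWord, collisionRelator, map_mul, map_inv,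
      inv_mul_eq_iff_eq_mul, eq_comm]
  simp only [key]
  constructor
  · rintro ⟨n, h1, h2⟩
    exact ⟨_, ⟨_, _, h1, rfl⟩, h2⟩
  · rintro ⟨_, ⟨e, k, h1, rfl⟩, h2⟩
    refine ⟨Nat.pair k e, ?_⟩
    rw [Nat.unpair_pair]
    exact ⟨h1, h2⟩

theorem isCE_collisionRelators (N : ℕ) : IsCE (collisionRelators p d N) := by
  have := isCE_image_collisionRelators (p := p) (MonoidHom.id (FreeGroup (Fin d))) N
  rwa [MonoidHom.coe_id, Set.image_id] at this

/-- Pigeonhole shows that some collision exists. The first one may be a different pair, but its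
elements are accepted by the same program and so lie in `W`. -/
theorem exists_mem_collisionRelators {W : Set (FreeGroup (Fin d))} (hW : W.Infinite)
    (hCE : IsCE W) (N : ℕ) :
    ∃ u ∈ W, ∃ v ∈ W, u ≠ v ∧ u⁻¹ * v ∈ collisionRelators p d N := by
  obtain ⟨e, he⟩ := hCE.exists_program
  obtain ⟨f, hf, g, hg, hne, h⟩ := exists_sameLowCoefs_of_infinite (p := p) hW (N + e)
  obtain ⟨m, hm⟩ := (he f.toWord).1 (by rwa [FreeGroup.mk_toWord])
  obtain ⟨n, hn⟩ := (he g.toWord).1 (by rwa [FreeGroup.mk_toWord])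
  have hcol : IsCollision p d N e (Encodable.encode (max m n, f.toWord, g.toWord)) := by
    rw [IsCollision, decodeTriple_encode]
    refine ⟨hm.mono (le_max_left _ _), hn.mono (le_max_right _ _), ?_, ?_⟩
    · rwa [FreeGroup.mk_toWord, FreeGroup.mk_toWord]
    · rwa [FreeGroup.mk_toWord, FreeGroup.mk_toWord]
  obtain ⟨k, hk⟩ := hcol.exists_first
  exact ⟨_, (he _).2 ⟨_, hk.1.1⟩, _, (he _).2 ⟨_, hk.1.2.1⟩, hk.1.2.2.1, e, k, hk, rfl⟩

theorem IsFirstCollision.mem_zassenhaus {N e k : ℕ} (h : IsFirstCollision p d N e k) :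
    collisionRelator d k ∈ zassenhaus p d (N + e) :=
  h.1.2.2.2.inv_mul_mem_zassenhaus

theorem collisionRelators_subset_zassenhaus (N : ℕ) :
    collisionRelators p d N ⊆ zassenhaus p d N := by
  rintro _ ⟨e, k, h, rfl⟩
  exact zassenhaus_antitone (Nat.le_add_right N e) h.mem_zassenhaus

/-- Each `e` contributes at most one relator, and its degree can be `i` only if `N + e ≤ i`. -/
theorem relatorsOfDegree_collisionRelators (N i : ℕ) :
    (relatorsOfDegree p (collisionRelators p d N) i).Finite ∧
      (relatorsOfDegree p (collisionRelators p d N) i).ncard ≤ i + 1 - N := by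
  classical
  let g : ℕ → FreeGroup (Fin d) := fun e =>
    if h : ∃ k, IsFirstCollision p d N e k then collisionRelator d h.choose else 1
  have hsub : relatorsOfDegree p (collisionRelators p d N) i ⊆
      (Finset.image g (Finset.range (i + 1 - N)) : Finset (FreeGroup (Fin d))) := by
    rintro _ ⟨⟨e, k, h, rfl⟩, _, h2⟩
    have hlt : N + e < i + 1 := by
      by_contra! hle
      exact h2 (zassenhaus_antitone hle h.mem_zassenhaus)
    rw [Finset.coe_image]
    refine ⟨e, Finset.mem_coe.2 (Finset.mem_range.2 (by omega)), ?_⟩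
    have hex : ∃ k, IsFirstCollision p d N e k := ⟨k, h⟩
    simp only [g, dif_pos hex]
    rw [hex.choose_spec.unique h]
  refine ⟨(Finset.finite_toSet _).subset hsub, ?_⟩
  refine (Set.ncard_le_ncard hsub (Finset.finite_toSet _)).trans ?_
  rw [Set.ncard_coe_finset]
  exact Finset.card_image_le.trans (Finset.card_range _).le

end Collisions

/-! ### Adding relators to a presentation. -/

section Presentations

variable {p d : ℕ}

theorem relatorsOfDegree_union (S E : Set (FreeGroup (Fin d))) (i : ℕ) :
    relatorsOfDegree p (S ∪ E) i = relatorsOfDegree p S i ∪ relatorsOfDegree p E i := by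
  ext r
  simp only [relatorsOfDegree, Set.mem_union, Set.mem_ofPred_eq]
  tauto

variable [Fact p.Prime]

theorem IsGolodShafarevichPresentation.infinite {S : Set (FreeGroup (Fin d))}
    (h : IsGolodShafarevichPresentation p S) : Infinite (PresentedGroup S) := by
  obtain ⟨hfin, t, ht0, ht1, hsum, hneg⟩ := h
  refine infinite_of_golodShafarevich S hfin ht0 ht1 hsum (lt_of_le_of_lt ?_ hneg)
  have h1 : (topRank (proPCompletion p (PresentedGroup S)) : ℝ) ≤ d := by
    exact_mod_cast topRank_proPCompletion_presentedGroup_le S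
  have := mul_le_mul_of_nonneg_right h1 ht0.le
  linarith

/-- A Golod–Shafarevich presentation remains one after the addition of the relators of the first
collisions, if these have high degree. -/
theorem IsGolodShafarevichPresentation.exists_union_collisionRelators
    {S : Set (FreeGroup (Fin d))} (h : IsGolodShafarevichPresentation p S) :
    ∃ N, IsGolodShafarevichPresentation p (S ∪ collisionRelators p d N) := by
  obtain ⟨hfin, t, ht0, ht1, hsum, hneg⟩ := h
  have hgeom : Summable fun i : ℕ => (i : ℝ) * t ^ i := by
    simpa using summable_pow_mul_geometric_of_norm_lt_one 1
      (r := t) (by rwa [Real.norm_of_nonneg ht0.le])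
  set C := ∑' i : ℕ, (i : ℝ) * t ^ i
  have hC : 0 ≤ C := tsum_nonneg fun i => by positivity
  set v := 1 - (topRank (proPCompletion p (PresentedGroup S)) : ℝ) * t +
      ∑' i : ℕ, ((relatorsOfDegree p S (i + 1)).ncard : ℝ) * t ^ (i + 1) with hv
  obtain ⟨M, hM⟩ := exists_pow_lt_of_lt_one (show 0 < -v / (C + 1) by
    apply div_pos <;> linarith) ht1
  rw [lt_div_iff₀ (by linarith)] at hM
  -- With this shift at most `i - M` new relators have degree `i + 1`, so they contribute at most `t
  -- ^ (M + 1) * C`, which is less than `-v`. It also ensures `N ≥ 2`, as needed for the rank to be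
  -- unchanged.
  set N := M + 2
  have hE := fun i => relatorsOfDegree_collisionRelators (p := p) (d := d) N (i + 1)
  let b : ℕ → ℝ := fun i => ((i - M : ℕ) : ℝ) * t ^ (i + 1)
  have hshift : (fun i => b (i + M)) = fun i : ℕ => t ^ (M + 1) * ((i : ℝ) * t ^ i) := by
    funext i
    simp only [b, Nat.add_sub_cancel]
    ring
  have hb : Summable b := by
    rw [← summable_nat_add_iff M, hshift]
    exact hgeom.mul_left _
  have hbsum : ∑' i, b i = t ^ (M + 1) * C := by
    rw [← hb.sum_add_tsum_nat_add M, hshift, tsum_mul_left, Finset.sum_eq_zero, zero_add]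
    intro i hi
    have : i - M = 0 := by have := Finset.mem_range.1 hi; omega
    simp [b, this]
  have hle : ∀ i : ℕ,
      ((relatorsOfDegree p (S ∪ collisionRelators p d N) (i + 1)).ncard : ℝ) * t ^ (i + 1) ≤
        ((relatorsOfDegree p S (i + 1)).ncard : ℝ) * t ^ (i + 1) + b i := by
    intro i
    rw [← add_mul]
    refine mul_le_mul_of_nonneg_right ?_ (by positivity)
    rw [relatorsOfDegree_union]
    have h1 := Set.ncard_union_le (relatorsOfDegree p S (i + 1))
      (relatorsOfDegree p (collisionRelators p d N) (i + 1))
    have h2 := (hE i).2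
    have h3 : i + 1 + 1 - N = i - M := by omega
    rw [h3] at h2
    exact_mod_cast h1.trans (Nat.add_le_add_left h2 _)
  have hsum' := Summable.of_nonneg_of_le (fun i => by positivity) hle (hsum.add hb)
  refine ⟨N, fun i => ?_, t, ht0, ht1, hsum', ?_⟩
  · rw [relatorsOfDegree_union]
    exact (hfin i).union (hE i).1
  · rw [topRank_union_eq S _ ((collisionRelators_subset_zassenhaus N).trans
      (zassenhaus_antitone (by omega)))]
    have h1 := hsum'.tsum_le_tsum hle (hsum.add hb)
    rw [hsum.tsum_add hb, hbsum] at h1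
    have h2 : t ^ (M + 1) * C ≤ t ^ M * C := by
      rw [pow_succ]
      have := pow_pos ht0 M
      have : t ^ M * t ≤ t ^ M := by nlinarith
      exact mul_le_mul_of_nonneg_right this hC
    have h3 := pow_pos ht0 M
    linarith

/-- The group presented by additional relators is the quotient by the normal closure of their
images. -/
theorem exists_presentedGroup_union_equiv {G : Type*} [Group G] {d : ℕ}
    {S : Set (FreeGroup (Fin d))} (e : PresentedGroup S ≃* G) (E : Set (FreeGroup (Fin d))) :
    Nonempty (PresentedGroup (S ∪ E) ≃*
      G ⧸ Subgroup.normalClosure ((fun r => e (PresentedGroup.mk S r)) '' E)) := by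
  set N := Subgroup.normalClosure ((fun r => e (PresentedGroup.mk S r)) '' E)
  let θ : FreeGroup (Fin d) →* G := e.toMonoidHom.comp (PresentedGroup.mk S)
  have hθ : Function.Surjective θ := e.surjective.comp (PresentedGroup.mk_surjective S)
  have hkerθ : θ.ker = Subgroup.normalClosure S := by
    ext x
    change e (PresentedGroup.mk S x) = 1 ↔ _
    rw [e.map_eq_one_iff]
    exact QuotientGroup.eq_one_iff x
  let ψ : FreeGroup (Fin d) →* G ⧸ N := (QuotientGroup.mk' N).comp θ
  have hψ : Function.Surjective ψ := (QuotientGroup.mk'_surjective N).comp hθ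
  have hker : ψ.ker = Subgroup.normalClosure (S ∪ E) := by
    have h1 : ψ.ker = N.comap θ := by
      rw [← MonoidHom.comap_ker, QuotientGroup.ker_mk']
    have h2 : N = (Subgroup.normalClosure E).map θ := by
      rw [Subgroup.map_normalClosure _ _ hθ]
      rfl
    rw [h1, h2, Subgroup.comap_map_eq, hkerθ, sup_comm]
    apply le_antisymm
    · exact sup_le (Subgroup.normalClosure_mono Set.subset_union_left)
        (Subgroup.normalClosure_mono Set.subset_union_right)
    · refine Subgroup.normalClosure_le_normal (Set.union_subset ?_ ?_)
      · exact Subgroup.subset_normalClosure.trans (SetLike.coe_subset_coe.2 le_sup_left)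
      · exact Subgroup.subset_normalClosure.trans (SetLike.coe_subset_coe.2 le_sup_right)
  exact ⟨(QuotientGroup.quotientMulEquivOfEq hker.symm).trans
    (QuotientGroup.quotientKerEquivOfSurjective ψ hψ)⟩

end Presentations

end GolodShafarevich

/-! ### The Dehn monster quotient. -/

theorem mainTheorem9 (p : ℕ) [Fact p.Prime]
    (Q : ∀ (H : Type u) [Group H], Prop)
    (hQ : ∀ (H : Type u) [Group H] (N : Subgroup H) [N.Normal], Q H → Q (H ⧸ N))
    (G : Type u) [Group G] (d : ℕ) (S : Set (FreeGroup (Fin d)))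
    (hG : Nonempty (PresentedGroup S ≃* G))
    (hGS : GolodShafarevich.IsGolodShafarevichPresentation p S)
    (hrec : GolodShafarevich.IsRecursivelyPresented G)
    (hQG : Q G) :
    ∃ (N : Subgroup G) (_ : N.Normal) (T : Set (FreeGroup (Fin d))),
      Nonempty (PresentedGroup T ≃* G ⧸ N) ∧
      GolodShafarevich.IsGolodShafarevichPresentation p T ∧
      (GolodShafarevich.IsCE S → GolodShafarevich.IsCE T) ∧
      GolodShafarevich.IsDehnMonster (G ⧸ N) ∧
      Q (G ⧸ N) := by
  open GolodShafarevich in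
  obtain ⟨e⟩ := hG
  obtain ⟨M, hM⟩ := hGS.exists_union_collisionRelators
  let N : Subgroup G := Subgroup.normalClosure
    ((fun r => e (PresentedGroup.mk S r)) '' collisionRelators p d M)
  obtain ⟨eT⟩ := exists_presentedGroup_union_equiv e (collisionRelators p d M)
  refine ⟨N, inferInstance, S ∪ collisionRelators p d M, ⟨eT⟩, hM,
    fun hS => hS.union (isCE_collisionRelators M), ⟨?_, ?_, ?_⟩, hQ G N hQG⟩
  · have := hM.infinite
    exact Infinite.of_injective eT eT.injective
  -- `S` itself need not be computably enumerable. The new relators are therefore translated by `φ`,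
  -- a lift of the identity of `G`, into a recursive presentation `S'` of `G`, where they have the
  -- same normal closure in `G`.
  · obtain ⟨d', S', hS', ⟨e'⟩⟩ := hrec
    choose x hx using fun i : Fin d => PresentedGroup.mk_surjective S'
      (e'.symm (e (PresentedGroup.of i)))
    let φ : FreeGroup (Fin d) →* FreeGroup (Fin d') := FreeGroup.lift x
    have hφ : ∀ r, e' (PresentedGroup.mk S' (φ r)) = e (PresentedGroup.mk S r) := by
      have : (e'.toMonoidHom.comp (PresentedGroup.mk S')).comp φ =
          e.toMonoidHom.comp (PresentedGroup.mk S) := by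
        refine FreeGroup.ext_hom _ _ fun i => ?_
        change e' (PresentedGroup.mk S' (FreeGroup.lift x (FreeGroup.of i))) = _
        rw [FreeGroup.lift_apply_of, hx, MulEquiv.apply_symm_apply]
        rfl
      exact DFunLike.congr_fun this
    refine ⟨d', S' ∪ φ '' collisionRelators p d M,
      hS'.union (isCE_image_collisionRelators φ M), ?_⟩
    have himage : (fun r => e' (PresentedGroup.mk S' r)) '' (φ '' collisionRelators p d M) =
        (fun r => e (PresentedGroup.mk S r)) '' collisionRelators p d M := by
      rw [Set.image_image]
      exact Set.image_congr' hφ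
    have h := exists_presentedGroup_union_equiv e' (φ '' collisionRelators p d M)
    rw [himage] at h
    exact h
  · refine ⟨d, (QuotientGroup.mk' N).comp (e.toMonoidHom.comp (PresentedGroup.mk S)),
      (QuotientGroup.mk'_surjective N).comp
        (e.surjective.comp (PresentedGroup.mk_surjective S)), fun W hW hCE => ?_⟩
    obtain ⟨u, hu, v, hv, hne, huv⟩ := exists_mem_collisionRelators (p := p) hW hCE M
    refine ⟨u, hu, v, hv, hne, ?_⟩
    change QuotientGroup.mk' N (e (PresentedGroup.mk S u)) =
      QuotientGroup.mk' N (e (PresentedGroup.mk S v))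
    refine QuotientGroup.eq.2 ?_
    rw [← map_inv, ← map_mul, ← map_inv, ← map_mul]
    exact Subgroup.subset_normalClosure ⟨_, huv, rfl⟩
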